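/- **Theorem 2 ($n^{3/4}$-law).** There exist $\varepsilon_0\in(0,\pi/6)$ and a constant $c>0$ such that the following holds. Let $0<\varepsilon<\varepsilon_0$, $1<r_0<\sqrt2$, and let $v_2:[0,\infty)\to\mathbb R\cup\{+\infty\}$ and $v_3:[0,2\pi]\to\mathbb R$ satisfy - $v_2(1)=-1$ and $v_2(r)>-1$ for all $r\neq 1$; $v_2(r)=0$ for all $r\ge r_0$; $v_2(r)>\varepsilon^{-1}$ for all $r\in[0,1-\varepsilon]$; - $v_3(\theta)=v_3(2\pi-\theta)$ for all $\theta\in[0,2\pi]$; $v_3(\pi/2)=v_3(\pi)=v_3(3\pi/2)=0$ and $v_3(\theta)>0$ for all other $\theta\in[0,2\pi]$; - $v_3(\theta)\ge 4(\pi/6-\varepsilon)^{-1}|\theta-\pi|$ for all $\theta\in[\pi-\varepsilon,\pi+\varepsilon]$, with equality only if $\theta=\pi$; - $v_3(\theta)>\frac{4}{(1-\varepsilon)^2}\big(\sqrt2+\tfrac12\big)^2$ for all $\theta\in[0,2\pi]$ outside $[\frac{\pi}{2}-\varepsilon,\frac{\pi}{2}+\varepsilon]\cup[\pi-\varepsilon,\pi+\varepsilon]\cup[\frac{3\pi}{2}-\varepsilon,\frac{3\pi}{2}+\varepsilon]$.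 For a set $C=\{x_1,\dots,x_n\}\subset\mathbb R^2$ of $n$ distinct points define the energy $$\mathcal F(C)=\frac12\sum_{i\ne j}v_2(|x_i-x_j|)+\frac12\sum_{(i,j,k)}v_3(\theta_{i,j,k}),$$ where the second sum runs over all ordered triples of pairwise distinct indices with $|x_i-x_j|\le r_0$ and $|x_i-x_k|\le r_0$, and $\theta_{i,j,k}\in[0,2\pi)$ is the angle from $x_j-x_i$ to $x_k-x_i$, counted clockwise. A ground state with $n$ particles is a minimizer of $\mathcal F$ among all sets of $n$ points in $\mathbb R^2$. Then for every $n\in\mathbb N$ and every ground state $C_n$ with $n$ particles there is a rigid motion $\varphi$ of $\mathbb R^2$ (a rotation followed by a translation) such that $$\#\big(\varphi(C_n)\,\triangle\, S_n\big)\le c\,n^{3/4},\qquad S_n:=[1,\lceil\sqrt n\rceil]^2\cap\mathbb Z^2 .$$ The constant $c$ does not depend on $n$, $\varepsilon$, $r_0$, $v_2$ or $v_3$. -/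

import Mathlib

open scoped symmDiff

noncomputable section

namespace SquareCrystal

/-- The admissibility conditions on the two-body potential `v₂ : [0,∞) → ℝ ∪ {+∞}` and on the
three-body potential `v₃ : [0,2π] → ℝ`, with parameter `ε` and interaction range `r₀`.
Only the values of `v₂` on `[0,∞)` and of `v₃` on `[0,2π]` are constrained (and used);
`min₂` excludes the value `-∞`. -/
structure Admissible (ε r₀ : ℝ) (v₂ : ℝ → EReal) (v₃ : ℝ → ℝ) : Prop where
  value_one₂ : v₂ 1 = -1
  min₂ : ∀ r : ℝ, 0 ≤ r → r ≠ 1 → -1 < v₂ r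
  one_lt_r₀ : 1 < r₀
  r₀_lt : r₀ < Real.sqrt 2
  cutoff₂ : ∀ r : ℝ, r₀ ≤ r → v₂ r = 0
  repulsion₂ : ∀ r : ℝ, 0 ≤ r → r ≤ 1 - ε → ((ε⁻¹ : ℝ) : EReal) < v₂ r
  symm₃ : ∀ θ ∈ Set.Icc 0 (2 * Real.pi), v₃ θ = v₃ (2 * Real.pi - θ)
  zero₃ : v₃ (Real.pi / 2) = 0 ∧ v₃ Real.pi = 0 ∧ v₃ (3 * Real.pi / 2) = 0
  pos₃ : ∀ θ ∈ Set.Icc 0 (2 * Real.pi),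
    θ ≠ Real.pi / 2 → θ ≠ Real.pi → θ ≠ 3 * Real.pi / 2 → 0 < v₃ θ
  slope₃ : ∀ θ ∈ Set.Icc (Real.pi - ε) (Real.pi + ε),
    4 * (Real.pi / 6 - ε)⁻¹ * |θ - Real.pi| ≤ v₃ θ ∧
      (v₃ θ = 4 * (Real.pi / 6 - ε)⁻¹ * |θ - Real.pi| → θ = Real.pi)
  large₃ : ∀ θ ∈ Set.Icc 0 (2 * Real.pi),
    θ ∉ Set.Icc (Real.pi / 2 - ε) (Real.pi / 2 + ε) →
    θ ∉ Set.Icc (Real.pi - ε) (Real.pi + ε) →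
    θ ∉ Set.Icc (3 * Real.pi / 2 - ε) (3 * Real.pi / 2 + ε) →
    4 / (1 - ε) ^ 2 * (Real.sqrt 2 + 1 / 2) ^ 2 < v₃ θ

/-- The angle in `[0, 2π)` from the nonzero vector `u` to the nonzero vector `w`, counted
clockwise; the plane `ℝ²` is identified with `ℂ`. -/
def cwAngle (u w : ℂ) : ℝ :=
  toIcoMod Real.two_pi_pos 0 (Complex.arg (u / w))

/-- The particles of `C` that are bonded to `x`, i.e. the particles other than `x` at distance at
most `r₀` from `x`. -/
def neighbors (r₀ : ℝ) (C : Finset ℂ) (x : ℂ) : Finset ℂ :=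
  (C.erase x).filter fun y => dist x y ≤ r₀

/-- The configurational energy: one half of the sum of `v₂` over the ordered pairs of distinct
particles plus one half of the sum of `v₃` over the bond angles, i.e. over the ordered triples
`(x, y, z)` where `y ≠ z` are both bonded to `x`. -/
def energy (r₀ : ℝ) (v₂ : ℝ → EReal) (v₃ : ℝ → ℝ) (C : Finset ℂ) : EReal :=
  ((1 / 2 : ℝ) : EReal) * (∑ x ∈ C, ∑ y ∈ C.erase x, v₂ (dist x y)) +
    (((1 / 2 : ℝ) * ∑ x ∈ C, ∑ y ∈ neighbors r₀ C x, ∑ z ∈ (neighbors r₀ C x).erase y,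
      v₃ (cwAngle (y - x) (z - x)) : ℝ) : EReal)

/-- `C` is a ground state with `n` particles: it minimizes the energy among all configurations
of `n` (distinct) points of the plane. -/
def IsGroundState (r₀ : ℝ) (v₂ : ℝ → EReal) (v₃ : ℝ → ℝ) (n : ℕ) (C : Finset ℂ) : Prop :=
  C.card = n ∧ ∀ D : Finset ℂ, D.card = n → energy r₀ v₂ v₃ C ≤ energy r₀ v₂ v₃ D

/-- A rigid motion of the plane: a rotation followed by a translation. -/
def IsRigidMotion (φ : ℂ → ℂ) : Prop :=
  ∃ a b : ℂ, ‖a‖ = 1 ∧ ∀ z, φ z = a * z + b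

/-- The square `S_n = [1, ⌈√n⌉]² ∩ ℤ²`. -/
def square (n : ℕ) : Finset ℂ :=
  (Finset.Icc (1 : ℤ) ⌈Real.sqrt n⌉ ×ˢ Finset.Icc (1 : ℤ) ⌈Real.sqrt n⌉).image
    fun k => (⟨(k.1 : ℝ), (k.2 : ℝ)⟩ : ℂ)

end SquareCrystal

end

/-!
The directions of the plane are divided into sixteen equal sectors. Since the bonds at a particle
make almost right angles, the bonds decompose into almost straight chains with directions near a
fixed sector, and every particle lies on two transversal chains (possibly without bonds).
Transversal chains meet at most once and three chains are never pairwise transversal, so by Mantel's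
theorem the number `R` of chains through `n` particles satisfies `4 * n ≤ R ^ 2`. Counting bonds
along chains, the energy is at least `R - 2 * n` plus a nonnegative defect: chains break where they
leave a sector, but on average over the rotations of the sectors this costs less than the slope of
`v₃` at `π` provides.

Filling a strip of the square lattice row by row attains the least possible `R`. Hence in a ground
state all defects vanish and the bonds form a connected graph, so a ground state is a subset of a
square lattice, and its projections to the axes have no gaps. It lies in an `a` by `b` rectangle
with `a + b ≤ ⌈2 * √n⌉` and `n ≤ a * b`. Both sides are then `√n + O(n ^ (1 / 4))`, and the
configuration differs from the square in `O(n ^ (3 / 4))` points.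
-/

noncomputable section

namespace SquareCrystal

open Real Complex Finset Relation

theorem four_mul_card_edgeFinset_le_sq_of_cliqueFree_three {V : Type*} [Fintype V]
    {G : SimpleGraph V} [DecidableRel G.Adj] (hG : G.CliqueFree 3) :
    4 * #G.edgeFinset ≤ Fintype.card V ^ 2 := by
  have turan : #G.edgeFinset ≤ #(SimpleGraph.turanGraph (Fintype.card V) 2).edgeFinset := by
    rw [SimpleGraph.card_edgeFinset_turanGraph]
    exact hG.card_edgeFinset_le (r := 2)
  have bound := SimpleGraph.mul_card_edgeFinset_turanGraph_le (n := Fintype.card V) (r := 2)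
  omega

/-! ### Cones around sixteen sectors -/

/-- The unit vector in the middle of the `T`-th of sixteen equal sectors of the plane; `s` is the
offset of the sectors, in units of their opening angle `π / 8`. -/
def sectorDir (s : ℝ) (T : ℤ) : ℂ :=
  cexp (((T + 1 / 2 + s) * (π / 8) : ℝ) * I)

/-- `v` lies in the convex cone of half-angle `arctan (1 / 4) > π / 16` around the direction
`sectorDir s T`: a neighborhood of the `T`-th sector that is stable under addition. -/
def InCone (s : ℝ) (T : ℤ) (v : ℂ) : Prop :=
  0 < (v / sectorDir s T).re ∧ |(v / sectorDir s T).im| ≤ (v / sectorDir s T).re / 4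

section Cone

variable {s : ℝ} {T T' : ℤ} {v w : ℂ}

theorem InCone.add (hv : InCone s T v) (hw : InCone s T w) : InCone s T (v + w) := by
  obtain ⟨hv₀, hv⟩ := hv
  obtain ⟨hw₀, hw⟩ := hw
  rw [InCone, add_div, add_re, add_im]
  exact ⟨by linarith, (abs_add_le _ _).trans (by linarith)⟩

theorem InCone.ne_zero (hv : InCone s T v) : v ≠ 0 := by
  rintro rfl
  simpa using hv.1

theorem sectorDir_add (s : ℝ) (T k : ℤ) :
    sectorDir s (T + k) = sectorDir s T * cexp ((k * (π / 8) : ℝ) * I) := by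
  rw [sectorDir, sectorDir, ← Complex.exp_add]
  congr 1
  push_cast
  ring

theorem sectorDir_add_eight (s : ℝ) (T : ℤ) : sectorDir s (T + 8) = -sectorDir s T := by
  have half_turn : (((8 : ℤ) * (π / 8) : ℝ) : ℂ) = π := by push_cast; ring
  rw [sectorDir_add, half_turn, exp_pi_mul_I, mul_neg_one]

theorem sectorDir_congr (s : ℝ) (h : T % 16 = T' % 16) : sectorDir s T = sectorDir s T' := by
  obtain ⟨k, rfl⟩ : ∃ k, T = T' + 16 * k := ⟨(T - T') / 16, by omega⟩
  have full_turns : ((((16 * k : ℤ) : ℝ) * (π / 8) : ℝ) : ℂ) * I = k * (2 * π * I) := by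
    push_cast; ring
  rw [sectorDir_add, full_turns, exp_int_mul_two_pi_mul_I, mul_one]

theorem InCone.congr (hv : InCone s T v) (h : T % 16 = T' % 16) : InCone s T' v := by
  rwa [InCone, ← sectorDir_congr s h]

theorem InCone.neg (hv : InCone s T v) : InCone s (T + 8) (-v) := by
  rwa [InCone, sectorDir_add_eight, neg_div_neg_eq]

theorem div_exp_ofReal_mul_I (z : ℂ) (t : ℝ) :
    z / cexp (t * I) =
      ⟨z.re * Real.cos t + z.im * Real.sin t, z.im * Real.cos t - z.re * Real.sin t⟩ := by
  rw [div_eq_mul_inv, ← Complex.exp_neg, ← neg_mul, ← ofReal_neg, exp_mul_I, ← ofReal_cos,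
    ← ofReal_sin]
  apply Complex.ext <;>
    simp only [mul_re, mul_im, add_re, add_im, ofReal_re, ofReal_im, I_re, I_im, Real.cos_neg,
      Real.sin_neg] <;>
    ring

theorem abs_trig_of_three_le_emod_eight {k : ℤ} (h₃ : 3 ≤ k % 8) (h₅ : k % 8 ≤ 5) :
    9 / 10 ≤ |Real.sin (k * (π / 8))| ∧ |Real.cos (k * (π / 8))| ≤ 4 / 10 := by
  obtain ⟨e, m, rfl, he⟩ : ∃ e m : ℤ, k = 4 + e + 8 * m ∧ |e| ≤ 1 :=
    ⟨k % 8 - 4, k / 8, by omega, abs_le.2 ⟨by omega, by omega⟩⟩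
  have angle : ((4 + e + 8 * m : ℤ) : ℝ) * (π / 8) = e * (π / 8) + π / 2 + m * π := by
    push_cast; ring
  have small : |(e : ℝ) * (π / 8)| ≤ 4 / 10 := by
    have he : |(e : ℝ)| ≤ 1 := by exact_mod_cast he
    rw [abs_mul, abs_of_pos (by positivity : 0 < π / 8)]
    nlinarith [pi_lt_d2, abs_nonneg (e : ℝ)]
  rw [angle, Real.sin_add_int_mul_pi, Real.cos_add_int_mul_pi, Real.sin_add_pi_div_two,
    Real.cos_add_pi_div_two]
  simp only [abs_mul, abs_neg, abs_zpow, abs_one, one_zpow, one_mul]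
  refine ⟨le_trans ?_ (le_abs_self _), Real.abs_sin_le_abs.trans small⟩
  nlinarith [Real.one_sub_sq_div_two_le_cos (x := e * (π / 8)), abs_le.1 small]

theorem InCone.not_inCone (hv : InCone s T v) (h₃ : 3 ≤ (T' - T) % 8) (h₅ : (T' - T) % 8 ≤ 5) :
    ¬InCone s T' v := by
  intro hv'
  obtain ⟨k, rfl⟩ : ∃ k, T' = T + k := ⟨T' - T, by ring⟩
  rw [add_sub_cancel_left] at h₃ h₅
  obtain ⟨hsin, hcos⟩ := abs_trig_of_three_le_emod_eight h₃ h₅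
  rw [InCone, sectorDir_add, ← div_div, div_exp_ofReal_mul_I] at hv'
  obtain ⟨ha, hb⟩ := hv
  replace hv' := hv'.2
  set a := (v / sectorDir s T).re
  set b := (v / sectorDir s T).im
  set S := Real.sin (k * (π / 8))
  set K := Real.cos (k * (π / 8))
  -- In the second frame the imaginary part `b K - a S` is at least `4 a / 5` in absolute value,
  -- the real part at most `13 a / 20`.
  have him : a * |S| - |b| * |K| ≤ |b * K - a * S| := by
    rw [← abs_of_pos ha, ← abs_mul, ← abs_mul, abs_of_pos ha, abs_sub_comm]
    exact abs_sub_abs_le_abs_sub _ _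
  have hre : a * K + b * S ≤ a * |K| + |b| * |S| := by
    rw [← abs_mul b S]
    gcongr <;> exact le_abs_self _
  have bK : |b| * |K| ≤ a / 4 * (4 / 10) := by gcongr
  have aS : a * (9 / 10) ≤ a * |S| := by gcongr
  have aK : a * |K| ≤ a * (4 / 10) := by gcongr
  have bS : |b| * |S| ≤ a / 4 * 1 := by gcongr; exact Real.abs_sin_le_one _
  linarith

theorem inCone_floor (s : ℝ) (hv : v ≠ 0) : InCone s ⌊8 / π * arg v - s⌋ v := by
  set T := ⌊8 / π * arg v - s⌋
  set φ := arg v - (T + 1 / 2 + s) * (π / 8) with hφ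
  have φ_small : |φ| ≤ 1 / 5 := by
    have half : |8 / π * arg v - s - T - 1 / 2| ≤ 1 / 2 := by
      rw [abs_le]
      constructor <;>
        linarith [Int.floor_le (8 / π * arg v - s), Int.lt_floor_add_one (8 / π * arg v - s)]
    have φ_eq : φ = π / 8 * (8 / π * arg v - s - T - 1 / 2) := by
      rw [hφ]; field_simp; ring
    rw [φ_eq, abs_mul, abs_of_pos (by positivity)]
    nlinarith [pi_lt_d2, pi_pos]
  have polar : v / sectorDir s T = (‖v‖ : ℝ) * cexp ((φ : ℝ) * I) := by
    conv_lhs => rw [← norm_mul_exp_arg_mul_I v]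
    rw [sectorDir, mul_div_assoc, ← Complex.exp_sub, hφ]
    congr 2
    push_cast
    ring
  have norm_pos : 0 < ‖v‖ := norm_pos_iff.2 hv
  have cos_large : 1 - φ ^ 2 / 2 ≤ Real.cos φ := Real.one_sub_sq_div_two_le_cos
  have sin_small : |Real.sin φ| ≤ 1 / 5 := Real.abs_sin_le_abs.trans φ_small
  have sq_small : φ ^ 2 ≤ 1 / 25 := by
    rw [← sq_abs]; nlinarith [abs_nonneg φ]
  rw [InCone, polar, re_ofReal_mul, im_ofReal_mul, exp_ofReal_mul_I_re, exp_ofReal_mul_I_im,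
    abs_mul, abs_of_pos norm_pos, mul_div_assoc]
  exact ⟨mul_pos norm_pos (by linarith), by gcongr; linarith⟩

end Cone

/-! ### Almost straight chains -/

/-- A decomposition of a graph drawn in the plane into almost straight chains. Every bond at a
vertex belongs to one of two axes; a pair of a vertex and an axis is called a *slot*. A bond has a
sector modulo `16` (a direction) and a slot has a sector modulo `8` (a direction up to sign). -/
structure ChainSystem {V : Type*} (G : SimpleGraph V) (pos : V → ℂ) where
  offset : ℝ
  axis : V → V → Bool
  sector : V → V → ℤ
  slotSector : V × Bool → ℤ
  sector_swap : ∀ {x y}, G.Adj x y → sector y x % 16 = (sector x y + 8) % 16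
  sector_ne : ∀ {x y z}, G.Adj x y → G.Adj x z → y ≠ z → axis x y = axis x z →
    sector x y % 16 ≠ sector x z % 16
  transversal : ∀ x, 3 ≤ (slotSector (x, true) - slotSector (x, false)) % 8 ∧
    (slotSector (x, true) - slotSector (x, false)) % 8 ≤ 5
  inCone : ∀ {x y}, G.Adj x y → InCone offset (sector x y) (pos y - pos x)

namespace ChainSystem

variable {V : Type*} {G : SimpleGraph V} {pos : V → ℂ} (K : ChainSystem G pos)

/-- The slot `b` comes immediately before the slot `a` on a chain: their vertices are joined by a
bond that belongs to both slots, and whose sector agrees modulo `8` with those of both. Chains are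
oriented by the sectors `0, …, 7`, so the bond seen from `a` has one of the sectors
`8, …, 15`. -/
def Precedes (b a : V × Bool) : Prop :=
  G.Adj a.1 b.1 ∧ K.axis a.1 b.1 = a.2 ∧ K.axis b.1 a.1 = b.2 ∧ 8 ≤ K.sector a.1 b.1 % 16 ∧
    K.sector a.1 b.1 % 8 = K.slotSector a % 8 ∧ K.sector a.1 b.1 % 8 = K.slotSector b % 8

/-- The slot `a` is the beginning of a chain. -/
def IsRoot (a : V × Bool) : Prop := ∀ b, ¬K.Precedes b a

variable {K} {a b c r : V × Bool} {x y : V}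

theorem Precedes.left_unique (hb : K.Precedes b a) (hc : K.Precedes c a) : b = c := by
  obtain ⟨adjb, axb, axb', hb, secb, -⟩ := hb
  obtain ⟨adjc, axc, axc', hc, secc, -⟩ := hc
  have fst_eq : b.1 = c.1 := by
    by_contra hne
    exact K.sector_ne adjb adjc hne (axb.trans axc.symm) (by omega)
  exact Prod.ext fst_eq (by rw [← axb', ← axc', fst_eq])

theorem Precedes.right_unique (hb : K.Precedes a b) (hc : K.Precedes a c) : b = c := by
  obtain ⟨adjb, axb, axb', hb, -, secb⟩ := hb
  obtain ⟨adjc, axc, axc', hc, -, secc⟩ := hc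
  have fst_eq : b.1 = c.1 := by
    by_contra hne
    have swapb := K.sector_swap adjb
    have swapc := K.sector_swap adjc
    exact K.sector_ne adjb.symm adjc.symm hne (axb'.trans axc'.symm) (by omega)
  exact Prod.ext fst_eq (by rw [← axb, ← axc, fst_eq])

theorem Precedes.inCone (h : K.Precedes b a) :
    InCone K.offset (K.slotSector a % 8) (pos a.1 - pos b.1) := by
  obtain ⟨adj, -, -, hback, sec, -⟩ := h
  rw [← neg_sub]
  exact (K.inCone adj).neg.congr (by omega)

theorem slotSector_of_reflTransGen (h : ReflTransGen K.Precedes b a) :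
    K.slotSector b % 8 = K.slotSector a % 8 := by
  induction h with
  | refl => rfl
  | tail _ h ih => exact ih.trans (h.2.2.2.2.2.symm.trans h.2.2.2.2.1)

theorem inCone_of_transGen (h : TransGen K.Precedes b a) :
    InCone K.offset (K.slotSector a % 8) (pos a.1 - pos b.1) := by
  induction h with
  | single h => exact h.inCone
  | tail _ h ih =>
    rw [slotSector_of_reflTransGen (.single h)] at ih
    rw [← sub_add_sub_cancel]
    exact h.inCone.add ih

theorem exists_isRoot [Finite V] (K : ChainSystem G pos) (a : V × Bool) :
    ∃ r, K.IsRoot r ∧ ReflTransGen K.Precedes r a := by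
  have : Std.Irrefl (TransGen K.Precedes) :=
    ⟨fun b h => (inCone_of_transGen h).ne_zero (sub_self _)⟩
  have wf : WellFounded (TransGen K.Precedes) := Finite.wellFounded_of_trans_of_irrefl _
  induction a using wf.induction with
  | _ a ih =>
    by_cases ha : K.IsRoot a
    · exact ⟨a, ha, .refl⟩
    · obtain ⟨b, hb⟩ := not_forall_not.1 ha
      obtain ⟨r, hr, hrb⟩ := ih b (.single hb)
      exact ⟨r, hr, hrb.tail hb⟩

theorem eq_or_inCone_of_reflTransGen (ha : ReflTransGen K.Precedes r a)
    (hb : ReflTransGen K.Precedes r b) :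
    a = b ∨ InCone K.offset (K.slotSector r % 8) (pos b.1 - pos a.1) ∨
      InCone K.offset (K.slotSector r % 8 + 8) (pos b.1 - pos a.1) := by
  rw [slotSector_of_reflTransGen ha]
  rcases ReflTransGen.total_of_right_unique (fun _ _ _ h h' => h.right_unique h') ha hb with h | h
  · rcases reflTransGen_iff_eq_or_transGen.1 h with h | h
    · exact .inl h.symm
    · rw [slotSector_of_reflTransGen h.to_reflTransGen]
      exact .inr (.inl (inCone_of_transGen h))
  · rcases reflTransGen_iff_eq_or_transGen.1 h with h | h
    · exact .inl h
    · rw [← neg_sub]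
      exact .inr (.inr (inCone_of_transGen h).neg)

theorem eq_of_transversal_chains {i j k l : Bool} {p q : V × Bool}
    (hpq : 3 ≤ (K.slotSector p - K.slotSector q) % 8 ∧
      (K.slotSector p - K.slotSector q) % 8 ≤ 5)
    (hpx : ReflTransGen K.Precedes p (x, i)) (hpy : ReflTransGen K.Precedes p (y, j))
    (hqx : ReflTransGen K.Precedes q (x, k)) (hqy : ReflTransGen K.Precedes q (y, l)) :
    x = y := by
  rcases eq_or_inCone_of_reflTransGen hpx hpy with h | hp
  · exact congrArg Prod.fst h
  rcases eq_or_inCone_of_reflTransGen hqx hqy with h | hq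
  · exact congrArg Prod.fst h
  rcases hp with hp | hp <;> rcases hq with hq | hq <;>
    exact (hq.not_inCone (by omega) (by omega) hp).elim

open scoped Classical in
theorem four_mul_card_le_sq_card_isRoot [Fintype V] (K : ChainSystem G pos) :
    4 * Fintype.card V ≤ Fintype.card {a // K.IsRoot a} ^ 2 := by
  choose root isRoot_root root_chain using K.exists_isRoot
  have slotSector_root (a) : K.slotSector (root a) % 8 = K.slotSector a % 8 :=
    slotSector_of_reflTransGen (root_chain a)
  -- Two roots are joined if their chains are transversal. Three slots are never pairwise
  -- transversal, and every vertex is the only intersection of its two chains.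
  let crossing : SimpleGraph {a // K.IsRoot a} :=
    { Adj a b := 3 ≤ (K.slotSector a - K.slotSector b) % 8 ∧
        (K.slotSector a - K.slotSector b) % 8 ≤ 5
      symm := ⟨fun a b h => by omega⟩
      loopless := ⟨fun a h => by omega⟩ }
  have triangle_free : crossing.CliqueFree 3 := by
    intro t ht
    obtain ⟨a, b, c, hab, hac, hbc, -⟩ := SimpleGraph.is3Clique_iff.1 ht
    simp only [crossing] at hab hac hbc
    omega
  let rootAt (x : V) (i : Bool) : {a // K.IsRoot a} := ⟨root (x, i), isRoot_root _⟩
  have adj (x : V) : crossing.Adj (rootAt x true) (rootAt x false) := by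
    have := K.transversal x
    have := slotSector_root (x, true)
    have := slotSector_root (x, false)
    simp only [crossing, rootAt]
    omega
  have injective : Function.Injective fun x => s(rootAt x true, rootAt x false) := by
    intro x y hxy
    simp only [Sym2.eq_iff, rootAt, Subtype.mk.injEq] at hxy
    rcases hxy with ⟨ht, hf⟩ | ⟨ht, hf⟩
    · exact eq_of_transversal_chains (adj x) (root_chain (x, true))
        (ht ▸ root_chain (y, true) :) (root_chain (x, false)) (hf ▸ root_chain (y, false) :)
    · exact eq_of_transversal_chains (adj x) (root_chain (x, true))
        (ht ▸ root_chain (y, false) :) (root_chain (x, false)) (hf ▸ root_chain (y, true) :)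
  have card_le : Fintype.card V ≤ #crossing.edgeFinset :=
    Finset.card_le_card_of_injOn _ (fun x _ => by simpa using adj x) injective.injOn
  have mantel := four_mul_card_edgeFinset_le_sq_of_cliqueFree_three triangle_free
  omega

section Count

variable [Fintype V] [DecidableRel G.Adj]

variable (K) in
/-- The oriented bonds whose sector differs from that of their slot, so that a chain breaks. -/
def badDarts : Finset G.Dart :=
  {d | K.sector d.fst d.snd % 8 ≠ K.slotSector (d.fst, K.axis d.fst d.snd) % 8}

theorem card_edgeFinset_le_card_backward (K : ChainSystem G pos) :
    #G.edgeFinset ≤ #{d : G.Dart | 8 ≤ K.sector d.fst d.snd % 16} := by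
  classical
  refine Finset.card_le_card_of_surjOn SimpleGraph.Dart.edge fun e he => ?_
  induction e with
  | _ x y =>
    have adj : G.Adj x y := by simpa using he
    have swap := K.sector_swap adj
    by_cases hxy : 8 ≤ K.sector x y % 16
    · exact ⟨⟨(x, y), adj⟩, by simpa using hxy, rfl⟩
    · exact ⟨⟨(y, x), adj.symm⟩, by
        simp only [coe_filter, Finset.mem_univ, true_and, Set.mem_ofPred_eq]
        omega, Sym2.eq_swap⟩

open scoped Classical in
theorem card_precedes_add_card_isRoot_le (K : ChainSystem G pos) :
    #{d : G.Dart | K.Precedes (d.snd, K.axis d.snd d.fst) (d.fst, K.axis d.fst d.snd)} +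
      Fintype.card {a // K.IsRoot a} ≤ 2 * Fintype.card V := by
  have injOn : #{d : G.Dart |
      K.Precedes (d.snd, K.axis d.snd d.fst) (d.fst, K.axis d.fst d.snd)} ≤
      #{a | ¬K.IsRoot a} := by
    refine Finset.card_le_card_of_injOn (fun d => (d.fst, K.axis d.fst d.snd)) ?_ ?_
    · intro d hd
      simp only [coe_filter, Finset.mem_univ, true_and, Set.mem_ofPred_eq] at hd ⊢
      exact fun hroot => hroot _ hd
    · intro d hd e he hde
      simp only [coe_filter, Finset.mem_univ, true_and, Set.mem_ofPred_eq] at hd he hde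
      rw [← hde] at he
      have fst_eq : d.fst = e.fst := (Prod.ext_iff.1 hde).1
      have snd_eq : d.snd = e.snd := congrArg Prod.fst (hd.left_unique he)
      exact SimpleGraph.Dart.ext _ _ (Prod.ext fst_eq snd_eq)
  have slots : #{a | K.IsRoot a} + #{a | ¬K.IsRoot a} = 2 * Fintype.card V := by
    rw [Finset.card_filter_add_card_filter_not, Finset.card_univ, Fintype.card_prod,
      Fintype.card_bool, mul_comm]
  rw [Fintype.card_subtype]
  omega

open scoped Classical in
theorem card_backward_le (K : ChainSystem G pos) :
    #{d : G.Dart | 8 ≤ K.sector d.fst d.snd % 16} ≤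
      #{d : G.Dart | K.Precedes (d.snd, K.axis d.snd d.fst) (d.fst, K.axis d.fst d.snd)} +
        #K.badDarts := by
  -- A backward bond that is no link of a chain is bad in one of its orientations.
  let bad (d : G.Dart) : G.Dart := if d ∈ K.badDarts then d else d.symm
  have hbad : #{d : G.Dart | 8 ≤ K.sector d.fst d.snd % 16 ∧
      ¬K.Precedes (d.snd, K.axis d.snd d.fst) (d.fst, K.axis d.fst d.snd)} ≤ #K.badDarts := by
    refine Finset.card_le_card_of_injOn bad ?_ ?_
    · intro d hd
      have swap := K.sector_swap d.adj
      simp only [coe_filter, Finset.mem_univ, true_and, Set.mem_ofPred_eq, Precedes, d.adj] at hd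
      by_cases h : d ∈ K.badDarts
      · simp only [bad, h, if_true, mem_coe]
      · simp only [badDarts, Finset.mem_filter, Finset.mem_univ, true_and, not_not] at h
        simp only [bad, badDarts, Finset.mem_filter, Finset.mem_univ, true_and, h, coe_filter,
          ne_eq, not_true_eq_false, if_false, Set.mem_ofPred_eq, SimpleGraph.Dart.symm,
          Prod.fst_swap, Prod.snd_swap]
        omega
    · intro d hd e he hde
      have swapd := K.sector_swap d.adj
      have swape := K.sector_swap e.adj
      simp only [coe_filter, Finset.mem_univ, true_and, Set.mem_ofPred_eq] at hd he
      simp only [bad] at hde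
      split_ifs at hde with h h' h'
      · exact hde
      · subst hde
        simp only [SimpleGraph.Dart.symm, Prod.fst_swap, Prod.snd_swap] at hd
        omega
      · subst hde
        simp only [SimpleGraph.Dart.symm, Prod.fst_swap, Prod.snd_swap] at he
        omega
      · exact SimpleGraph.Dart.symm_involutive.injective hde
  rw [← Finset.card_filter_add_card_filter_not (s := {d : G.Dart | 8 ≤ K.sector d.fst d.snd % 16})
    (fun d => K.Precedes (d.snd, K.axis d.snd d.fst) (d.fst, K.axis d.fst d.snd)),
    Finset.filter_filter, Finset.filter_filter]
  exact add_le_add (Finset.card_le_card (Finset.monotone_filter_right _ fun d _ h => h.2)) hbad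

open scoped Classical in
theorem card_edgeFinset_add_card_isRoot_le (K : ChainSystem G pos) :
    #G.edgeFinset + Fintype.card {a // K.IsRoot a} ≤ 2 * Fintype.card V + #K.badDarts := by
  have := K.card_edgeFinset_le_card_backward
  have := K.card_backward_le
  have := K.card_precedes_add_card_isRoot_le
  omega

end Count

end ChainSystem

/-! ### Averaging over shifted grids -/

theorem intervalIntegrable_fract_sub (a : ℝ) :
    IntervalIntegrable (fun s => Int.fract (a - s)) MeasureTheory.volume 0 1 := by
  rw [intervalIntegrable_iff]
  refine MeasureTheory.Measure.integrableOn_of_bounded (M := 1) (by simp) ?_ ?_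
  · exact (measurable_fract.comp (measurable_const.sub measurable_id)).aestronglyMeasurable
  · refine Filter.Eventually.of_forall fun s => ?_
    rw [Real.norm_eq_abs, abs_of_nonneg (Int.fract_nonneg _)]
    exact (Int.fract_lt_one _).le

theorem integral_fract_sub (a : ℝ) :
    ∫ s in (0 : ℝ)..1, Int.fract (a - s) = ∫ s in (0 : ℝ)..1, Int.fract s := by
  have periodic : Function.Periodic (fun s : ℝ => Int.fract s) 1 := fun s => Int.fract_add_one s
  rw [intervalIntegral.integral_comp_sub_left (fun s => Int.fract s) a]
  simpa using periodic.intervalIntegral_add_eq (a - 1) 0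

theorem floor_sub_sub_floor_sub (a b s : ℝ) :
    (⌊a - s⌋ - ⌊b - s⌋ : ℝ) = a - b - Int.fract (a - s) + Int.fract (b - s) := by
  linarith [Int.floor_add_fract (a - s), Int.floor_add_fract (b - s)]

theorem intervalIntegrable_floor_sub_sub_floor_sub (a b : ℝ) :
    IntervalIntegrable (fun s => (⌊a - s⌋ - ⌊b - s⌋ : ℝ)) MeasureTheory.volume 0 1 := by
  simp_rw [floor_sub_sub_floor_sub]
  exact (intervalIntegrable_const.sub (intervalIntegrable_fract_sub a)).add
    (intervalIntegrable_fract_sub b)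

theorem integral_floor_sub_sub_floor_sub (a b : ℝ) :
    ∫ s in (0 : ℝ)..1, (⌊a - s⌋ - ⌊b - s⌋ : ℝ) = a - b := by
  simp_rw [floor_sub_sub_floor_sub]
  rw [intervalIntegral.integral_add
      (intervalIntegrable_const.sub (intervalIntegrable_fract_sub a))
      (intervalIntegrable_fract_sub b),
    intervalIntegral.integral_sub intervalIntegrable_const (intervalIntegrable_fract_sub a),
    integral_fract_sub, integral_fract_sub]
  simp

theorem integral_abs_floor_sub_sub_floor_sub (a b : ℝ) :
    ∫ s in (0 : ℝ)..1, |(⌊a - s⌋ - ⌊b - s⌋ : ℝ)| = |a - b| := by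
  wlog h : b ≤ a generalizing a b
  · have swapped := this b a (le_of_not_ge h)
    simp_rw [abs_sub_comm] at swapped ⊢
    exact swapped
  have nonneg (s : ℝ) : 0 ≤ (⌊a - s⌋ - ⌊b - s⌋ : ℝ) := by
    have : ⌊b - s⌋ ≤ ⌊a - s⌋ := Int.floor_le_floor (by linarith)
    exact sub_nonneg.2 (by exact_mod_cast this)
  simp_rw [abs_of_nonneg (nonneg _), abs_of_nonneg (sub_nonneg.2 h)]
  exact integral_floor_sub_sub_floor_sub a b

theorem exists_card_floor_ne_le_sum_abs_sub {ι : Type*} (J : Finset ι) (a b : ι → ℝ) :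
    ∃ s : ℝ, (#{i ∈ J | ⌊a i - s⌋ ≠ ⌊b i - s⌋} : ℝ) ≤ ∑ i ∈ J, |a i - b i| := by
  have integrable (i) : IntervalIntegrable (fun s => |(⌊a i - s⌋ - ⌊b i - s⌋ : ℝ)|)
      MeasureTheory.volume 0 1 :=
    (intervalIntegrable_floor_sub_sub_floor_sub (a i) (b i)).abs
  have integral_eq : ∫ s in (0 : ℝ)..1, ∑ i ∈ J, |(⌊a i - s⌋ - ⌊b i - s⌋ : ℝ)| =
      ∑ i ∈ J, |a i - b i| := by
    rw [intervalIntegral.integral_finsetSum fun i _ => integrable i]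
    exact Finset.sum_congr rfl fun i _ => integral_abs_floor_sub_sub_floor_sub (a i) (b i)
  have sum_integrable : MeasureTheory.IntegrableOn
      (fun s => ∑ i ∈ J, |(⌊a i - s⌋ - ⌊b i - s⌋ : ℝ)|) (Set.Ioc 0 1) :=
    MeasureTheory.integrable_finsetSum J fun i _ =>
      (intervalIntegrable_iff_integrableOn_Ioc_of_le zero_le_one).1 (integrable i)
  obtain ⟨s, -, hs⟩ := MeasureTheory.exists_le_setAverage (by simp) (by simp) sum_integrable
  rw [MeasureTheory.setAverage_eq, ← intervalIntegral.integral_of_le zero_le_one, integral_eq] at hs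
  refine ⟨s, le_trans ?_ (hs.trans_eq (by simp))⟩
  rw [Finset.card_filter, Nat.cast_sum]
  refine Finset.sum_le_sum fun i _ => ?_
  split_ifs with h
  · exact_mod_cast Int.one_le_abs (sub_ne_zero.2 h)
  · simp

/-! ### Graphs with almost right angles -/

/-- The multiple of a right angle nearest to `arg u - arg w`, in units of a right angle. -/
def quarter (u w : ℂ) : ℤ := round ((arg u - arg w) / (π / 2))

/-- The deviation of `arg u - arg w` from the nearest multiple of a right angle. -/
def deviation (u w : ℂ) : ℝ := arg u - arg w - quarter u w * (π / 2)

/-- The argument in units of a sixteenth of a full turn. -/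
def direction (u : ℂ) : ℝ := 8 / π * arg u

theorem quarter_self (u : ℂ) : quarter u u = 0 := by simp [quarter]

theorem deviation_self (u : ℂ) : deviation u u = 0 := by simp [deviation, quarter_self]

theorem direction_sub (u w : ℂ) :
    direction u - direction w = 4 * quarter u w + 8 / π * deviation u w := by
  rw [direction, direction, deviation]
  field_simp
  ring

theorem exists_direction_neg {u : ℂ} (h : u ≠ 0) :
    ∃ k : ℤ, direction (-u) = direction u + (8 + 16 * k : ℤ) := by
  have angle := arg_neg_coe_angle h
  rw [← Real.Angle.coe_add, Real.Angle.angle_eq_iff_two_pi_dvd_sub] at angle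
  obtain ⟨k, hk⟩ := angle
  refine ⟨k, ?_⟩
  rw [direction, direction, eq_add_of_sub_eq hk]
  push_cast
  field_simp
  ring

/-- All angles between edges at a common vertex are close to a nonzero multiple of a right
angle. -/
def RegularAngles {V : Type*} (G : SimpleGraph V) (pos : V → ℂ) : Prop :=
  ∀ ⦃x y z⦄, G.Adj x y → G.Adj x z → y ≠ z →
    |deviation (pos y - pos x) (pos z - pos x)| ≤ 1 / 100 ∧
      quarter (pos y - pos x) (pos z - pos x) % 4 ≠ 0

namespace RegularAngles

variable {V : Type*} {G : SimpleGraph V} {pos : V → ℂ} {x y z w : V}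

theorem abs_deviation_le (hG : RegularAngles G pos) (hy : G.Adj x y) (hz : G.Adj x z) :
    |deviation (pos y - pos x) (pos z - pos x)| ≤ 1 / 100 := by
  rcases eq_or_ne y z with rfl | h
  · rw [deviation_self]; norm_num
  · exact (hG hy hz h).1

theorem quarter_add (hG : RegularAngles G pos) (hy : G.Adj x y) (hz : G.Adj x z)
    (hw : G.Adj x w) : quarter (pos y - pos x) (pos w - pos x) =
      quarter (pos y - pos x) (pos z - pos x) + quarter (pos z - pos x) (pos w - pos x) := by
  have hyz := hG.abs_deviation_le hy hz
  have hzw := hG.abs_deviation_le hz hw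
  have hyw := hG.abs_deviation_le hy hw
  set u := pos y - pos x
  set v := pos z - pos x
  set t := pos w - pos x
  have cocycle : deviation u t - deviation u v - deviation v t =
      ((quarter u v + quarter v t - quarter u t : ℤ) : ℝ) * (π / 2) := by
    simp only [deviation]; push_cast; ring
  have small : |deviation u t - deviation u v - deviation v t| ≤ 3 / 100 := by
    rw [abs_le] at *
    constructor <;> linarith
  by_contra hne
  have one_le : (1 : ℝ) ≤ |((quarter u v + quarter v t - quarter u t : ℤ) : ℝ)| := by
    exact_mod_cast Int.one_le_abs (by omega)
  rw [cocycle, abs_mul, abs_of_pos (by positivity : 0 < π / 2)] at small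
  nlinarith [pi_gt_three]

theorem abs_floor_direction_sub (hG : RegularAngles G pos) (s : ℝ) (hy : G.Adj x y)
    (hz : G.Adj x z) :
    |⌊direction (pos y - pos x) - s⌋ - ⌊direction (pos z - pos x) - s⌋ -
      4 * quarter (pos y - pos x) (pos z - pos x)| ≤ 1 := by
  have hyz := hG.abs_deviation_le hy hz
  set u := pos y - pos x
  set v := pos z - pos x
  have small : |8 / π * deviation u v| < 1 := by
    have : 8 / π ≤ 3 := by rw [div_le_iff₀ pi_pos]; linarith [pi_gt_three]
    rw [abs_mul, abs_of_pos (by positivity)]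
    nlinarith [abs_nonneg (deviation u v)]
  rw [← Int.lt_add_one_iff, ← Int.cast_lt (R := ℝ)]
  push_cast
  rw [abs_lt] at small ⊢
  constructor <;>
    linarith [direction_sub u v, Int.floor_le (direction u - s), Int.floor_le (direction v - s),
      Int.lt_floor_add_one (direction u - s), Int.lt_floor_add_one (direction v - s)]

theorem exists_axes (hG : RegularAngles G pos) (s : ℝ) (x : V) :
    ∃ (axis : V → Bool) (σ : Bool → ℤ),
      (∀ y z, G.Adj x y → G.Adj x z →
        (axis y = axis z ↔ quarter (pos y - pos x) (pos z - pos x) % 2 = 0)) ∧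
      (3 ≤ (σ true - σ false) % 8 ∧ (σ true - σ false) % 8 ≤ 5) ∧
      ∀ y, G.Adj x y →
        ∃ z, G.Adj x z ∧ axis z = axis y ∧ σ (axis y) = ⌊direction (pos z - pos x) - s⌋ := by
  by_cases isolated : ∀ w, ¬G.Adj x w
  · exact ⟨fun _ => true, fun i => cond i 4 0, fun y _ hy => (isolated y hy).elim, by simp,
      fun y hy => (isolated y hy).elim⟩
  obtain ⟨w, hw⟩ := not_forall_not.1 isolated
  let axis (y : V) : Bool := quarter (pos y - pos x) (pos w - pos x) % 2 = 0
  have axis_w : axis w = true := by simp [axis, quarter_self]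
  have axis_eq_iff (y z) (hy : G.Adj x y) (hz : G.Adj x z) :
      axis y = axis z ↔ quarter (pos y - pos x) (pos z - pos x) % 2 = 0 := by
    have := hG.quarter_add hy hz hw
    simp only [axis, decide_eq_decide]
    omega
  by_cases second : ∃ v, G.Adj x v ∧ axis v = false
  · obtain ⟨v, hv, axis_v⟩ := second
    refine ⟨axis, fun i => ⌊direction (pos (cond i w v) - pos x) - s⌋, axis_eq_iff, ?_,
      fun y _ => ?_⟩
    · have odd := (axis_eq_iff w v hw hv).not.1 (by rw [axis_w, axis_v]; decide)
      have := abs_le.1 (hG.abs_floor_direction_sub s hw hv)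
      simp only [cond_true, cond_false]
      omega
    · cases axis y
      · exact ⟨v, hv, axis_v, rfl⟩
      · exact ⟨w, hw, axis_w, rfl⟩
  · refine ⟨axis, fun i => ⌊direction (pos w - pos x) - s⌋ + cond i 0 4, axis_eq_iff, ?_,
      fun y hy => ?_⟩
    · simp only [cond_true, cond_false]
      omega
    · have axis_y : axis y = true := by simpa using fun h => second ⟨y, hy, h⟩
      exact ⟨w, hw, by rw [axis_w, axis_y], by simp [axis_y]⟩

end RegularAngles

section StraightAngles

variable {V : Type*} [Fintype V] [DecidableEq V] (G : SimpleGraph V) [DecidableRel G.Adj]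
  (pos : V → ℂ)

/-- The triples `(x, y, z)` for which the angle from `z` to `y` at `x` is almost straight. -/
def straightAngles : Finset (V × V × V) :=
  {t | G.Adj t.1 t.2.1 ∧ G.Adj t.1 t.2.2 ∧ t.2.2 ≠ t.2.1 ∧
    quarter (pos t.2.1 - pos t.1) (pos t.2.2 - pos t.1) % 4 = 2}

variable {G pos}

theorem RegularAngles.exists_chainSystem (hG : RegularAngles G pos)
    (hpos : ∀ x y, G.Adj x y → pos x ≠ pos y) (s : ℝ) :
    ∃ K : ChainSystem G pos, #K.badDarts ≤ #{t ∈ straightAngles G pos |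
      ⌊direction (pos t.2.1 - pos t.1) - s⌋ ≠ ⌊direction (pos t.2.2 - pos t.1) +
        4 * quarter (pos t.2.1 - pos t.1) (pos t.2.2 - pos t.1) - s⌋} := by
  choose axis σ axis_eq_iff transversal rep adj_rep axis_rep σ_eq using hG.exists_axes s
  let K : ChainSystem G pos :=
    { offset := s
      axis := axis
      sector x y := ⌊direction (pos y - pos x) - s⌋
      slotSector a := σ a.1 a.2
      sector_swap {x y} h := by
        obtain ⟨k, hk⟩ := exists_direction_neg (sub_ne_zero.2 (hpos x y h).symm)
        rw [← neg_sub (pos y), hk, add_sub_right_comm, Int.floor_add_intCast]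
        omega
      sector_ne {x y z} hy hz hne hax := by
        have even := (axis_eq_iff x y z hy hz).1 hax
        have nonzero := (hG hy hz hne).2
        have := abs_le.1 (hG.abs_floor_direction_sub s hy hz)
        omega
      transversal := transversal
      inCone {x y} h := inCone_floor s (sub_ne_zero.2 (hpos x y h).symm) }
  refine ⟨K, Finset.card_le_card_of_injOn
    (fun d => (d.fst, d.snd, rep d.fst d.snd d.adj)) (fun d hd => ?_) fun d _ e _ h => ?_⟩
  · have bad : ⌊direction (pos d.snd - pos d.fst) - s⌋ % 8 ≠
        σ d.fst (axis d.fst d.snd) % 8 := (Finset.mem_filter.1 hd).2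
    rw [σ_eq d.fst d.snd d.adj] at bad
    have adj := adj_rep d.fst d.snd d.adj
    have ne : rep d.fst d.snd d.adj ≠ d.snd := fun h => bad (by rw [h])
    have even := (axis_eq_iff _ _ _ d.adj adj).1 (axis_rep d.fst d.snd d.adj).symm
    have nonzero := (hG d.adj adj ne.symm).2
    refine Finset.mem_coe.2 (Finset.mem_filter.2 ⟨?_, ?_⟩)
    · simp only [straightAngles, Finset.mem_filter, Finset.mem_univ, true_and]
      exact ⟨d.adj, adj, ne, by omega⟩
    · have floor_add (r : ℝ) (k : ℤ) : ⌊r + 4 * k - s⌋ = ⌊r - s⌋ + 4 * k := by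
        rw [add_sub_right_comm]
        exact_mod_cast Int.floor_add_intCast (r - s) (4 * k)
      simp only [floor_add]
      omega
  · simp only [Prod.mk.injEq] at h
    exact SimpleGraph.Dart.ext _ _ (Prod.ext h.1 h.2.1)

theorem RegularAngles.exists_chain_number (hG : RegularAngles G pos)
    (hpos : ∀ x y, G.Adj x y → pos x ≠ pos y) :
    ∃ R : ℕ, 4 * Fintype.card V ≤ R ^ 2 ∧ (#G.edgeFinset + R : ℝ) ≤ 2 * Fintype.card V +
      8 / π * ∑ t ∈ straightAngles G pos,
        |deviation (pos t.2.1 - pos t.1) (pos t.2.2 - pos t.1)| := by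
  classical
  obtain ⟨s, hs⟩ := exists_card_floor_ne_le_sum_abs_sub (straightAngles G pos)
    (fun t => direction (pos t.2.1 - pos t.1)) (fun t => direction (pos t.2.2 - pos t.1) +
      4 * quarter (pos t.2.1 - pos t.1) (pos t.2.2 - pos t.1))
  obtain ⟨K, hK⟩ := hG.exists_chainSystem hpos s
  refine ⟨Fintype.card {a // K.IsRoot a}, K.four_mul_card_le_sq_card_isRoot, ?_⟩
  have count : (#G.edgeFinset + Fintype.card {a // K.IsRoot a} : ℝ) ≤
      2 * Fintype.card V + #K.badDarts := by
    exact_mod_cast K.card_edgeFinset_add_card_isRoot_le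
  refine count.trans ?_
  gcongr
  refine (Nat.cast_le.2 hK).trans (hs.trans_eq ?_)
  rw [Finset.mul_sum]
  refine Finset.sum_congr rfl fun t _ => ?_
  rw [← sub_sub, direction_sub, add_sub_cancel_left, abs_mul, abs_of_pos (by positivity)]

end StraightAngles

/-! ### The energy -/

theorem coe_sum_ereal {ι : Type*} (s : Finset ι) (f : ι → ℝ) :
    ((∑ i ∈ s, f i : ℝ) : EReal) = ∑ i ∈ s, (f i : EReal) :=
  map_sum (⟨⟨Real.toEReal, EReal.coe_zero⟩, EReal.coe_add⟩ : ℝ →+ EReal) f s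

theorem sum_ereal_ne_bot {ι : Type*} {s : Finset ι} {f : ι → EReal} (h : ∀ i ∈ s, f i ≠ ⊥) :
    ∑ i ∈ s, f i ≠ ⊥ := fun hbot =>
  let ⟨i, hi, hfi⟩ := WithBot.sum_eq_bot_iff.1 hbot
  h i hi hfi

theorem ne_top_of_sum_ereal_ne_top {ι : Type*} {s : Finset ι} {f : ι → EReal}
    (h : ∀ i ∈ s, f i ≠ ⊥) (hs : ∑ i ∈ s, f i ≠ ⊤) {i : ι} (hi : i ∈ s) : f i ≠ ⊤ := by
  classical
  intro htop
  apply hs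
  rw [← Finset.add_sum_erase _ _ hi, htop]
  exact EReal.top_add_of_ne_bot (sum_ereal_ne_bot fun j hj => h j (Finset.mem_of_mem_erase hj))

theorem mem_neighbors {r₀ : ℝ} {C : Finset ℂ} {x y : ℂ} :
    y ∈ neighbors r₀ C x ↔ y ≠ x ∧ y ∈ C ∧ dist x y ≤ r₀ := by
  rw [neighbors, Finset.mem_filter, Finset.mem_erase, and_assoc]

theorem neighbors_mono {r₀ : ℝ} {A C : Finset ℂ} (h : A ⊆ C) (x : ℂ) :
    neighbors r₀ A x ⊆ neighbors r₀ C x :=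
  Finset.filter_subset_filter _ (Finset.erase_subset_erase _ h)

theorem neighbors_union_of_lt_dist {r₀ : ℝ} {A B : Finset ℂ} {x : ℂ}
    (hB : ∀ y ∈ B, r₀ < dist x y) : neighbors r₀ (A ∪ B) x = neighbors r₀ A x := by
  ext y
  have := hB y
  simp only [mem_neighbors, Finset.mem_union]
  grind

theorem cwAngle_eq_ite (u w : ℂ) :
    cwAngle u w = if 0 ≤ arg (u / w) then arg (u / w) else arg (u / w) + 2 * π := by
  have lower := neg_pi_lt_arg (u / w)
  have upper := arg_le_pi (u / w)
  split_ifs with h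
  · exact (toIcoMod_eq_self _).2 ⟨h, by linarith⟩
  · rw [cwAngle, ← toIcoMod_add_right]
    exact (toIcoMod_eq_self _).2 ⟨by linarith, by linarith⟩

theorem cwAngle_mem_Icc (u w : ℂ) : cwAngle u w ∈ Set.Icc 0 (2 * π) := by
  have := toIcoMod_mem_Ico Real.two_pi_pos 0 (arg (u / w))
  rw [zero_add] at this
  exact Set.Ico_subset_Icc_self this

theorem cwAngle_swap (u w : ℂ) :
    cwAngle w u = cwAngle u w ∨ cwAngle w u = 2 * π - cwAngle u w := by
  have inv : arg (w / u) = if arg (u / w) = π then π else -arg (u / w) := by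
    rw [← inv_div u w, arg_inv]
  have := Real.pi_pos
  rw [cwAngle_eq_ite u w, cwAngle_eq_ite w u, inv]
  split_ifs <;> grind

theorem exists_cwAngle_eq {u w : ℂ} (hu : u ≠ 0) (hw : w ≠ 0) :
    ∃ k : ℤ, cwAngle u w = arg u - arg w + 2 * π * k := by
  have angle := arg_div_coe_angle hu hw
  rw [← Real.Angle.coe_sub, Real.Angle.angle_eq_iff_two_pi_dvd_sub] at angle
  obtain ⟨k, hk⟩ := angle
  rw [cwAngle_eq_ite]
  split_ifs
  · exact ⟨k, by linarith⟩
  · exact ⟨k + 1, by push_cast; linarith⟩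

theorem exp_cwAngle_mul_I {u w : ℂ} (hw : w ≠ 0) (h : ‖u‖ = ‖w‖) :
    Complex.exp (cwAngle u w * I) = u / w := by
  have polar : Complex.exp (arg (u / w) * I) = u / w := by
    have := norm_mul_exp_arg_mul_I (u / w)
    rwa [norm_div, h, div_self (norm_ne_zero_iff.2 hw), ofReal_one, one_mul] at this
  rw [cwAngle_eq_ite]
  split_ifs
  · exact polar
  · push_cast
    rw [add_mul, Complex.exp_periodic, polar]

/-- The two-body energy of the particle `x` with the particles of `C` other than `x`. It is the
physical one as long as no two of these particles have infinite energy (`toReal ⊤ = 0`). -/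
def pairEnergy (v₂ : ℝ → EReal) (C : Finset ℂ) (x : ℂ) : ℝ :=
  ∑ y ∈ C.erase x, (v₂ (dist x y)).toReal

/-- The three-body energy of the ordered pairs of bonds at `x`. -/
def angleEnergy (r₀ : ℝ) (v₃ : ℝ → ℝ) (C : Finset ℂ) (x : ℂ) : ℝ :=
  ∑ y ∈ neighbors r₀ C x, ∑ z ∈ (neighbors r₀ C x).erase y, v₃ (cwAngle (y - x) (z - x))

/-- The contribution of the particle `x` to the energy. -/
def siteEnergy (r₀ : ℝ) (v₂ : ℝ → EReal) (v₃ : ℝ → ℝ) (C : Finset ℂ) (x : ℂ) : ℝ :=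
  1 / 2 * pairEnergy v₂ C x + 1 / 2 * angleEnergy r₀ v₃ C x

/-- The real number that the energy is for configurations of finite energy. -/
def realEnergy (r₀ : ℝ) (v₂ : ℝ → EReal) (v₃ : ℝ → ℝ) (C : Finset ℂ) : ℝ :=
  ∑ x ∈ C, siteEnergy r₀ v₂ v₃ C x

/-- No two particles have infinite interaction energy. -/
def FinitePairs (v₂ : ℝ → EReal) (C : Finset ℂ) : Prop :=
  ∀ x ∈ C, ∀ y ∈ C, x ≠ y → v₂ (dist x y) ≠ ⊤

namespace Admissible

variable {ε r₀ : ℝ} {v₂ : ℝ → EReal} {v₃ : ℝ → ℝ}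

variable (H : Admissible ε r₀ v₂ v₃)
include H

theorem v₂_ne_bot {r : ℝ} (hr : 0 ≤ r) : v₂ r ≠ ⊥ := by
  rcases eq_or_ne r 1 with rfl | h
  · rw [H.value_one₂]
    decide
  · exact (bot_le.trans_lt (H.min₂ r hr h)).ne'

theorem toReal_one : (v₂ 1).toReal = -1 := by simp [H.value_one₂]

theorem neg_one_lt_toReal {r : ℝ} (hr : 0 ≤ r) (htop : v₂ r ≠ ⊤) (h : r ≠ 1) :
    -1 < (v₂ r).toReal := by
  have := H.min₂ r hr h
  rw [← EReal.coe_toReal htop (H.v₂_ne_bot hr)] at this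
  exact EReal.coe_lt_coe_iff.1 (by simpa using this)

theorem neg_one_le_toReal {r : ℝ} (hr : 0 ≤ r) (htop : v₂ r ≠ ⊤) : -1 ≤ (v₂ r).toReal := by
  rcases eq_or_ne r 1 with rfl | h
  · exact H.toReal_one.ge
  · exact (H.neg_one_lt_toReal hr htop h).le

theorem toReal_eq_zero {r : ℝ} (hr : r₀ ≤ r) : (v₂ r).toReal = 0 := by
  rw [H.cutoff₂ r hr, EReal.toReal_zero]

theorem energy_eq_coe {C : Finset ℂ} (hC : FinitePairs v₂ C) :
    energy r₀ v₂ v₃ C = (realEnergy r₀ v₂ v₃ C : EReal) := by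
  have pairs : ∑ x ∈ C, ∑ y ∈ C.erase x, v₂ (dist x y) =
      ((∑ x ∈ C, pairEnergy v₂ C x : ℝ) : EReal) := by
    simp only [pairEnergy, coe_sum_ereal]
    refine Finset.sum_congr rfl fun x hx => Finset.sum_congr rfl fun y hy => ?_
    obtain ⟨hne, hy⟩ := Finset.mem_erase.1 hy
    rw [EReal.coe_toReal (hC x hx y hy hne.symm) (H.v₂_ne_bot dist_nonneg)]
  rw [energy, pairs, ← EReal.coe_mul, ← EReal.coe_add, EReal.coe_eq_coe_iff, realEnergy]
  simp only [siteEnergy, angleEnergy, Finset.sum_add_distrib, Finset.mul_sum]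

theorem finitePairs_of_energy_ne_top {C : Finset ℂ} (hC : energy r₀ v₂ v₃ C ≠ ⊤) :
    FinitePairs v₂ C := by
  have pair_ne_bot : ∀ x, ∀ y ∈ C.erase x, v₂ (dist x y) ≠ ⊥ := fun _ _ _ =>
    H.v₂_ne_bot dist_nonneg
  have sum_ne_top : ∑ x ∈ C, ∑ y ∈ C.erase x, v₂ (dist x y) ≠ ⊤ := by
    intro h
    apply hC
    rw [energy, h, EReal.coe_mul_top_of_pos (by norm_num)]
    exact EReal.top_add_coe _
  intro x hx y hy hxy
  have site_ne_top := ne_top_of_sum_ereal_ne_top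
    (fun x _ => sum_ereal_ne_bot (pair_ne_bot x)) sum_ne_top hx
  exact ne_top_of_sum_ereal_ne_top (pair_ne_bot x) site_ne_top
    (Finset.mem_erase.2 ⟨hxy.symm, hy⟩)

theorem v₃_eq_zero_iff (u w : ℂ) : v₃ (cwAngle u w) = 0 ↔
    cwAngle u w = π / 2 ∨ cwAngle u w = π ∨ cwAngle u w = 3 * π / 2 := by
  constructor
  · intro h
    by_contra! hne
    exact (H.pos₃ _ (cwAngle_mem_Icc u w) hne.1 hne.2.1 hne.2.2).ne' h
  · rintro (h | h | h) <;> rw [h]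
    exacts [H.zero₃.1, H.zero₃.2.1, H.zero₃.2.2]

theorem v₃_nonneg (u w : ℂ) : 0 ≤ v₃ (cwAngle u w) := by
  by_cases h : cwAngle u w = π / 2 ∨ cwAngle u w = π ∨ cwAngle u w = 3 * π / 2
  · exact ((H.v₃_eq_zero_iff u w).2 h).ge
  · push Not at h
    exact (H.pos₃ _ (cwAngle_mem_Icc u w) h.1 h.2.1 h.2.2).le

theorem angleEnergy_nonneg (C : Finset ℂ) (x : ℂ) : 0 ≤ angleEnergy r₀ v₃ C x :=
  Finset.sum_nonneg fun _ _ => Finset.sum_nonneg fun _ _ => H.v₃_nonneg _ _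

theorem angleEnergy_mono {A C : Finset ℂ} (h : A ⊆ C) (x : ℂ) :
    angleEnergy r₀ v₃ A x ≤ angleEnergy r₀ v₃ C x := calc
  angleEnergy r₀ v₃ A x ≤ ∑ y ∈ neighbors r₀ A x, ∑ z ∈ (neighbors r₀ C x).erase y,
      v₃ (cwAngle (y - x) (z - x)) := by
    refine Finset.sum_le_sum fun y _ => Finset.sum_le_sum_of_subset_of_nonneg
      (Finset.erase_subset_erase _ (neighbors_mono h x)) fun z _ _ => H.v₃_nonneg _ _
  _ ≤ angleEnergy r₀ v₃ C x :=
    Finset.sum_le_sum_of_subset_of_nonneg (neighbors_mono h x) fun y _ _ =>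
      Finset.sum_nonneg fun _ _ => H.v₃_nonneg _ _

theorem siteEnergy_union_of_lt_dist {A B : Finset ℂ} {x : ℂ} (hAB : Disjoint A B)
    (hx : x ∉ B) (hB : ∀ y ∈ B, r₀ < dist x y) :
    siteEnergy r₀ v₂ v₃ (A ∪ B) x = siteEnergy r₀ v₂ v₃ A x := by
  rw [siteEnergy, siteEnergy, pairEnergy, pairEnergy, angleEnergy, angleEnergy,
    neighbors_union_of_lt_dist hB, Finset.erase_union_distrib, Finset.erase_eq_of_notMem hx,
    Finset.sum_union (Finset.disjoint_of_subset_left (Finset.erase_subset _ _) hAB),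
    Finset.sum_eq_zero (s := B) fun y hy => H.toReal_eq_zero (hB y hy).le, add_zero]

theorem realEnergy_union {A B : Finset ℂ} (hAB : ∀ x ∈ A, ∀ y ∈ B, r₀ < dist x y) :
    realEnergy r₀ v₂ v₃ (A ∪ B) = realEnergy r₀ v₂ v₃ A + realEnergy r₀ v₂ v₃ B := by
  have disjoint : Disjoint A B := by
    refine Finset.disjoint_left.2 fun x hA hB => ?_
    have := hAB x hA x hB
    rw [dist_self] at this
    linarith [H.one_lt_r₀]
  rw [realEnergy, Finset.sum_union disjoint]
  refine congrArg₂ (· + ·) (Finset.sum_congr rfl fun x hx => ?_)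
    (Finset.sum_congr rfl fun y hy => ?_)
  · exact H.siteEnergy_union_of_lt_dist disjoint (Finset.disjoint_left.1 disjoint hx) (hAB x hx)
  · rw [Finset.union_comm]
    exact H.siteEnergy_union_of_lt_dist disjoint.symm (Finset.disjoint_right.1 disjoint hy)
      fun x hx => dist_comm x y ▸ hAB x hx y hy

theorem realEnergy_add_le_realEnergy_insert {A : Finset ℂ} {x : ℂ} (hx : x ∉ A) :
    realEnergy r₀ v₂ v₃ A + pairEnergy v₂ (insert x A) x +
      1 / 2 * angleEnergy r₀ v₃ (insert x A) x ≤ realEnergy r₀ v₂ v₃ (insert x A) := by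
  have site_le : ∀ y ∈ A, siteEnergy r₀ v₂ v₃ A y + 1 / 2 * (v₂ (dist x y)).toReal ≤
      siteEnergy r₀ v₂ v₃ (insert x A) y := by
    intro y hy
    have hne : x ≠ y := fun h => hx (h ▸ hy)
    have pairs : pairEnergy v₂ (insert x A) y =
        (v₂ (dist x y)).toReal + pairEnergy v₂ A y := by
      rw [pairEnergy, Finset.erase_insert_of_ne hne,
        Finset.sum_insert fun h => hx (Finset.mem_of_mem_erase h), dist_comm, pairEnergy]
    have angles := H.angleEnergy_mono (Finset.subset_insert x A) y
    rw [siteEnergy, siteEnergy, pairs]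
    linarith
  have sum_le := Finset.sum_le_sum site_le
  rw [Finset.sum_add_distrib, ← Finset.mul_sum] at sum_le
  have pairs : pairEnergy v₂ (insert x A) x = ∑ y ∈ A, (v₂ (dist x y)).toReal := by
    rw [pairEnergy, Finset.erase_insert hx]
  rw [realEnergy, realEnergy, Finset.sum_insert hx, siteEnergy, pairs]
  linarith

end Admissible

/-! ### The square lattice -/

/-- The embedding of the square lattice `ℤ²` into the plane. -/
def latticePoint : ℤ × ℤ →+ ℂ :=
  AddMonoidHom.mk' (fun k => ⟨k.1, k.2⟩) fun p q => by apply Complex.ext <;> simp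

theorem latticePoint_apply (a b : ℤ) : latticePoint (a, b) = a + b * I := by
  apply Complex.ext <;> simp [latticePoint]

theorem latticePoint_injective : Function.Injective latticePoint := by
  rintro ⟨a, b⟩ ⟨c, d⟩ h
  simpa [latticePoint] using h

theorem sq_norm_latticePoint (k : ℤ × ℤ) :
    ‖latticePoint k‖ ^ 2 = ((k.1 ^ 2 + k.2 ^ 2 : ℤ) : ℝ) := by
  rw [Complex.sq_norm, Complex.normSq_apply]
  simp [latticePoint, sq]

/-- The vectors joining a lattice point to its four neighbors. -/
def unitSteps : Finset (ℤ × ℤ) := {(1, 0), (-1, 0), (0, 1), (0, -1)}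

theorem mem_unitSteps {e : ℤ × ℤ} : e ∈ unitSteps ↔ e.1 ^ 2 + e.2 ^ 2 = 1 := by
  obtain ⟨a, b⟩ := e
  simp only [unitSteps, Finset.mem_insert, Finset.mem_singleton, Prod.mk.injEq]
  constructor
  · rintro (⟨rfl, rfl⟩ | ⟨rfl, rfl⟩ | ⟨rfl, rfl⟩ | ⟨rfl, rfl⟩) <;> norm_num
  · intro h
    have : -1 ≤ a := by nlinarith [sq_nonneg b]
    have : a ≤ 1 := by nlinarith [sq_nonneg b]
    have : -1 ≤ b := by nlinarith [sq_nonneg a]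
    have : b ≤ 1 := by nlinarith [sq_nonneg a]
    interval_cases a <;> interval_cases b <;> simp_all

theorem norm_latticePoint_of_mem_unitSteps {e : ℤ × ℤ} (he : e ∈ unitSteps) :
    ‖latticePoint e‖ = 1 := by
  rw [← pow_eq_one_iff_of_nonneg (norm_nonneg _) two_ne_zero, sq_norm_latticePoint,
    mem_unitSteps.1 he, Int.cast_one]

theorem sqrt_two_le_norm_latticePoint {k : ℤ × ℤ} (h₀ : k ≠ 0) (h : k ∉ unitSteps) :
    √2 ≤ ‖latticePoint k‖ := by
  rw [mem_unitSteps] at h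
  have ne_zero : k.1 ^ 2 + k.2 ^ 2 ≠ 0 := fun h => h₀ (Prod.ext
    (by simpa using ((add_eq_zero_iff_of_nonneg (sq_nonneg _) (sq_nonneg _)).1 h).1)
    (by simpa using ((add_eq_zero_iff_of_nonneg (sq_nonneg _) (sq_nonneg _)).1 h).2))
  have two_le : 2 ≤ k.1 ^ 2 + k.2 ^ 2 := by
    have := add_nonneg (sq_nonneg k.1) (sq_nonneg k.2)
    omega
  rw [Real.sqrt_le_left (norm_nonneg _), sq_norm_latticePoint]
  exact_mod_cast two_le

theorem pow_four_eq_one_iff {q : ℂ} : q ^ 4 = 1 ↔ q = 1 ∨ q = -1 ∨ q = I ∨ q = -I := by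
  constructor
  · intro h
    have factored : (q - 1) * ((q + 1) * ((q - I) * (q + I))) = 0 := by
      linear_combination h - (q ^ 2 - 1) * I_sq
    simpa [sub_eq_zero, add_eq_zero_iff_eq_neg] using factored
  · rintro (rfl | rfl | rfl | rfl) <;> simp [Even.neg_pow (n := 4) (by decide)]

theorem latticePoint_pow_four {e : ℤ × ℤ} (he : e ∈ unitSteps) : latticePoint e ^ 4 = 1 := by
  simp only [unitSteps, Finset.mem_insert, Finset.mem_singleton] at he
  rcases he with rfl | rfl | rfl | rfl <;>
    simp [latticePoint_apply, pow_four_eq_one_iff]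

theorem exists_unitStep_of_pow_four_eq {u v : ℂ} (hu : u ≠ 0) (h : v ^ 4 = u ^ 4) :
    ∃ e ∈ unitSteps, v = u * latticePoint e := by
  have root : (v / u) ^ 4 = 1 := by rw [div_pow, h, div_self (pow_ne_zero _ hu)]
  suffices ∃ e ∈ unitSteps, v / u = latticePoint e by
    obtain ⟨e, he, hv⟩ := this
    exact ⟨e, he, by rw [← hv, mul_div_cancel₀ _ hu]⟩
  rcases pow_four_eq_one_iff.1 root with h | h | h | h
  · exact ⟨(1, 0), by decide, by simp [h, latticePoint_apply]⟩
  · exact ⟨(-1, 0), by decide, by simp [h, latticePoint_apply]⟩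
  · exact ⟨(0, 1), by decide, by simp [h, latticePoint_apply]⟩
  · exact ⟨(0, -1), by decide, by simp [h, latticePoint_apply]⟩

theorem cwAngle_of_pow_four_eq {u w : ℂ} (hw : w ≠ 0) (hne : u ≠ w) (h : u ^ 4 = w ^ 4) :
    cwAngle u w = π / 2 ∨ cwAngle u w = π ∨ cwAngle u w = 3 * π / 2 := by
  have := Real.pi_pos
  have root : (u / w) ^ 4 = 1 := by rw [div_pow, h, div_self (pow_ne_zero _ hw)]
  rw [cwAngle_eq_ite]
  rcases pow_four_eq_one_iff.1 root with h | h | h | h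
  · exact absurd ((div_eq_one_iff_eq hw).1 h) hne
  · rw [h, arg_neg_one]
    grind
  · rw [h, arg_I]
    grind
  · rw [h, arg_neg_I]
    grind

theorem pow_four_eq_of_cwAngle {u w : ℂ} (hw : w ≠ 0) (hnorm : ‖u‖ = ‖w‖)
    (h : cwAngle u w = π / 2 ∨ cwAngle u w = π ∨ cwAngle u w = 3 * π / 2) : u ^ 4 = w ^ 4 := by
  have root : (u / w) ^ 4 = 1 := by
    rw [← exp_cwAngle_mul_I hw hnorm, pow_four_eq_one_iff]
    rcases h with h | h | h <;> rw [h]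
    · right; right; left
      push_cast
      exact Complex.exp_pi_div_two_mul_I
    · right; left
      exact Complex.exp_pi_mul_I
    · right; right; right
      rw [show ((3 * π / 2 : ℝ) : ℂ) * I = π * I + π / 2 * I by push_cast; ring, Complex.exp_add,
        Complex.exp_pi_mul_I, Complex.exp_pi_div_two_mul_I, neg_one_mul]
  rwa [div_pow, div_eq_one_iff_eq (pow_ne_zero _ hw)] at root

section Translates

variable {G : Type*} [AddGroup G] [DecidableEq G]

/-- The elements of `P` whose translate by `e` is also in `P`. For a unit vector `e` of the square
lattice they correspond to the bonds of `P` parallel to `e`. -/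
def bondsAlong (P : Finset G) (e : G) : Finset G := {p ∈ P | p + e ∈ P}

theorem card_bondsAlong_neg (P : Finset G) (e : G) : #(bondsAlong P (-e)) = #(bondsAlong P e) := by
  refine Finset.card_nbij' (· + -e) (· + e) ?_ ?_ ?_ ?_ <;>
    simp +contextual [Set.MapsTo, Set.LeftInvOn, bondsAlong]

theorem card_bondsAlong_add_card_filter_not (P : Finset G) (e : G) :
    #(bondsAlong P e) + #{p ∈ P | p + e ∉ P} = #P :=
  Finset.card_filter_add_card_filter_not _

-- Each fibre of `φ` in `P` has an element minimizing `ψ`, whose translate by `e` is not in `P`.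
theorem card_image_add_card_bondsAlong_le {α : Type*} [DecidableEq α] (P : Finset G) {e : G}
    {φ : G → α} {ψ : G → ℤ} (hφ : ∀ p, φ (p + e) = φ p) (hψ : ∀ p, ψ (p + e) < ψ p) :
    #(P.image φ) + #(bondsAlong P e) ≤ #P := by
  have surj : P.image φ ⊆ {p ∈ P | p + e ∉ P}.image φ := by
    intro j hj
    obtain ⟨q, hq, rfl⟩ := Finset.mem_image.1 hj
    obtain ⟨p, hp, hmin⟩ := Finset.exists_min_image {p ∈ P | φ p = φ q} ψ
      ⟨q, Finset.mem_filter.2 ⟨hq, rfl⟩⟩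
    obtain ⟨hp, hpq⟩ := Finset.mem_filter.1 hp
    refine Finset.mem_image.2 ⟨p, Finset.mem_filter.2 ⟨hp, fun hpe => ?_⟩, hpq⟩
    exact (hmin _ (Finset.mem_filter.2 ⟨hpe, by rw [hφ, hpq]⟩)).not_gt (hψ p)
  have card_le := (Finset.card_le_card surj).trans Finset.card_image_le
  have := card_bondsAlong_add_card_filter_not P e
  omega

end Translates

theorem sum_card_unitSteps (P : Finset (ℤ × ℤ)) : ∑ p ∈ P, #{e ∈ unitSteps | p + e ∈ P} =
    2 * (#(bondsAlong P (-1, 0)) + #(bondsAlong P (0, -1))) := by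
  have swap : ∑ p ∈ P, #{e ∈ unitSteps | p + e ∈ P} = ∑ e ∈ unitSteps, #(bondsAlong P e) := by
    simp_rw [bondsAlong, Finset.card_filter]
    exact Finset.sum_comm
  have horizontal := card_bondsAlong_neg P (-1, 0)
  have vertical := card_bondsAlong_neg P (0, -1)
  simp only [Prod.neg_mk, neg_zero, neg_neg] at horizontal vertical
  rw [swap, unitSteps, Finset.sum_insert (by decide), Finset.sum_insert (by decide),
    Finset.sum_insert (by decide), Finset.sum_singleton, horizontal, vertical]
  ring

/-- The first `n` points of the strip `[0, b) × [0, ∞)` of the square lattice, row by row. -/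
def rowFilling (n b : ℕ) : Finset (ℤ × ℤ) :=
  (Finset.range n).image fun k => (((k % b : ℕ) : ℤ), ((k / b : ℕ) : ℤ))

theorem card_rowFilling (n b : ℕ) : #(rowFilling n b) = n := by
  rw [rowFilling, Finset.card_image_of_injective, Finset.card_range]
  intro k l h
  simp only [Prod.mk.injEq, Nat.cast_inj] at h
  rw [← Nat.div_add_mod k b, ← Nat.div_add_mod l b, h.1, h.2]

theorem mem_rowFilling {n b : ℕ} (hb : 0 < b) {p : ℤ × ℤ} :
    p ∈ rowFilling n b ↔ 0 ≤ p.1 ∧ p.1 < b ∧ 0 ≤ p.2 ∧ p.1 + b * p.2 < n := by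
  simp only [rowFilling, Finset.mem_image, Finset.mem_range]
  constructor
  · rintro ⟨k, hk, rfl⟩
    have bound : k % b + b * (k / b) < n := by rwa [Nat.mod_add_div]
    dsimp only
    exact ⟨by positivity, by exact_mod_cast k.mod_lt hb, by positivity, by exact_mod_cast bound⟩
  · obtain ⟨i, j⟩ := p
    rintro ⟨hi, hib, hj, hij⟩
    lift i to ℕ using hi
    lift j to ℕ using hj
    dsimp only at hib hij
    have hib : i < b := by exact_mod_cast hib
    refine ⟨i + b * j, by exact_mod_cast hij, ?_⟩
    rw [Nat.add_mul_mod_self_left, Nat.mod_eq_of_lt hib, Nat.add_mul_div_left _ _ hb,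
      Nat.div_eq_of_lt hib, zero_add]

theorem card_rowFilling_leftmost_le {n a b : ℕ} (hb : 0 < b) (h : n ≤ a * b) :
    #{p ∈ rowFilling n b | p + (-1, 0) ∉ rowFilling n b} ≤ a := by
  calc _ ≤ #((Finset.Ico (0 : ℤ) a).image fun j => ((0 : ℤ), j)) := ?_
    _ ≤ #(Finset.Ico (0 : ℤ) a) := Finset.card_image_le
    _ = a := by simp
  refine Finset.card_le_card fun ⟨i, j⟩ hp => ?_
  simp only [Finset.mem_filter, mem_rowFilling hb, Prod.mk_add_mk] at hp
  have hi : i = 0 := by grind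
  have hj : (b : ℤ) * j < b * a := by
    have : (n : ℤ) ≤ a * b := by exact_mod_cast h
    linarith
  simp [hi, hp.1.2.2.1, lt_of_mul_lt_mul_left hj b.cast_nonneg]

theorem card_rowFilling_lowest_le {n b : ℕ} (hb : 0 < b) :
    #{p ∈ rowFilling n b | p + (0, -1) ∉ rowFilling n b} ≤ b := by
  calc _ ≤ #((Finset.Ico (0 : ℤ) b).image fun i => (i, (0 : ℤ))) := ?_
    _ ≤ #(Finset.Ico (0 : ℤ) b) := Finset.card_image_le
    _ = b := by simp
  refine Finset.card_le_card fun ⟨i, j⟩ hp => ?_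
  simp only [Finset.mem_filter, mem_rowFilling hb, Prod.mk_add_mk] at hp
  have hj : j = 0 := by
    have : (b : ℤ) * (j + -1) = b * j - b := by ring
    grind
  simp [hj, hp.1.1, hp.1.2.1]

theorem two_mul_le_bonds_rowFilling {n a b : ℕ} (hb : 0 < b) (h : n ≤ a * b) :
    2 * n ≤ #(bondsAlong (rowFilling n b) (-1, 0)) +
      #(bondsAlong (rowFilling n b) (0, -1)) + (a + b) := by
  have horizontal := card_bondsAlong_add_card_filter_not (rowFilling n b) (-1, 0)
  have vertical := card_bondsAlong_add_card_filter_not (rowFilling n b) (0, -1)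
  have leftmost := card_rowFilling_leftmost_le hb h
  have lowest := card_rowFilling_lowest_le (n := n) hb
  rw [card_rowFilling] at horizontal vertical
  omega

theorem le_half_mul_half {n R : ℕ} (h : 4 * n ≤ R ^ 2) : n ≤ R / 2 * (R - R / 2) := by
  obtain ⟨m, rfl | rfl⟩ := Nat.even_or_odd' R
  · rw [show 2 * m / 2 = m by omega, show 2 * m - m = m by omega]
    nlinarith
  · rw [show (2 * m + 1) / 2 = m by omega, show 2 * m + 1 - m = m + 1 by omega]
    nlinarith

namespace Admissible

variable {ε r₀ : ℝ} {v₂ : ℝ → EReal} {v₃ : ℝ → ℝ}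

variable (H : Admissible ε r₀ v₂ v₃)
include H

theorem v₂_dist_latticePoint {p q : ℤ × ℤ} (h : p ≠ q) :
    v₂ (dist (latticePoint p) (latticePoint q)) = if q - p ∈ unitSteps then -1 else 0 := by
  rw [dist_comm, dist_eq_norm, ← map_sub]
  split_ifs with he
  · rw [norm_latticePoint_of_mem_unitSteps he, H.value_one₂]
  · exact H.cutoff₂ _ (H.r₀_lt.le.trans
      (sqrt_two_le_norm_latticePoint (sub_ne_zero.2 h.symm) he))

theorem finitePairs_lattice (P : Finset (ℤ × ℤ)) : FinitePairs v₂ (P.image latticePoint) := by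
  intro x hx y hy hxy
  obtain ⟨p, -, rfl⟩ := Finset.mem_image.1 hx
  obtain ⟨q, -, rfl⟩ := Finset.mem_image.1 hy
  rw [H.v₂_dist_latticePoint (fun h => hxy (congrArg _ h))]
  split_ifs <;> decide

theorem pow_four_of_mem_neighbors_lattice {P : Finset (ℤ × ℤ)} {p : ℤ × ℤ} {y : ℂ}
    (hy : y ∈ neighbors r₀ (P.image latticePoint) (latticePoint p)) :
    (y - latticePoint p) ^ 4 = 1 := by
  obtain ⟨hne, hy, hd⟩ := mem_neighbors.1 hy
  obtain ⟨q, -, rfl⟩ := Finset.mem_image.1 hy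
  rw [dist_comm, dist_eq_norm, ← map_sub] at hd
  rw [← map_sub]
  refine latticePoint_pow_four (by_contra fun hqp => ?_)
  have := sqrt_two_le_norm_latticePoint (sub_ne_zero.2 fun h => hne (congrArg _ h)) hqp
  linarith [H.r₀_lt]

theorem angleEnergy_lattice (P : Finset (ℤ × ℤ)) (p : ℤ × ℤ) :
    angleEnergy r₀ v₃ (P.image latticePoint) (latticePoint p) = 0 := by
  refine Finset.sum_eq_zero fun y hy => Finset.sum_eq_zero fun z hz => ?_
  obtain ⟨hzy, hz⟩ := Finset.mem_erase.1 hz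
  rw [H.v₃_eq_zero_iff]
  refine cwAngle_of_pow_four_eq (sub_ne_zero.2 (mem_neighbors.1 hz).1)
    (fun h => hzy (sub_left_injective h).symm) ?_
  rw [H.pow_four_of_mem_neighbors_lattice hy, H.pow_four_of_mem_neighbors_lattice hz]

theorem pairEnergy_lattice (P : Finset (ℤ × ℤ)) (p : ℤ × ℤ) :
    pairEnergy v₂ (P.image latticePoint) (latticePoint p) =
      -(#{e ∈ unitSteps | p + e ∈ P} : ℝ) := by
  have steps : (P.erase p).filter (fun q => q - p ∈ unitSteps) =
      {e ∈ unitSteps | p + e ∈ P}.image (p + ·) := by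
    have zero_notMem : (0 : ℤ × ℤ) ∉ unitSteps := by decide
    ext q
    simp only [Finset.mem_filter, Finset.mem_erase, Finset.mem_image]
    constructor
    · exact fun h => ⟨q - p, ⟨h.2, by simpa using h.1.2⟩, by abel⟩
    · rintro ⟨e, ⟨he, hpe⟩, rfl⟩
      exact ⟨⟨fun h => zero_notMem (add_eq_left.1 h ▸ he), hpe⟩, by simpa using he⟩
  have value : ∀ q ∈ P.erase p, (v₂ (dist (latticePoint p) (latticePoint q))).toReal =
      -(if q - p ∈ unitSteps then 1 else 0) := by
    intro q hq
    rw [H.v₂_dist_latticePoint (Finset.ne_of_mem_erase hq).symm]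
    split_ifs <;> simp
  rw [pairEnergy, ← Finset.image_erase latticePoint_injective,
    Finset.sum_image latticePoint_injective.injOn, Finset.sum_congr rfl value,
    Finset.sum_neg_distrib, Finset.sum_boole, steps,
    Finset.card_image_of_injective _ (add_right_injective p)]

theorem realEnergy_lattice (P : Finset (ℤ × ℤ)) : realEnergy r₀ v₂ v₃ (P.image latticePoint) =
    -((#(bondsAlong P (-1, 0)) + #(bondsAlong P (0, -1)) : ℕ) : ℝ) := by
  have sum_steps : (∑ p ∈ P, (#{e ∈ unitSteps | p + e ∈ P} : ℝ)) =
      2 * (#(bondsAlong P (-1, 0)) + #(bondsAlong P (0, -1)) : ℕ) := by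
    exact_mod_cast sum_card_unitSteps P
  rw [realEnergy, Finset.sum_image latticePoint_injective.injOn]
  simp only [siteEnergy, H.angleEnergy_lattice, H.pairEnergy_lattice]
  rw [Finset.sum_add_distrib, ← Finset.mul_sum, Finset.sum_neg_distrib, sum_steps]
  simp

theorem exists_energy_le {n R : ℕ} (hR : 4 * n ≤ R ^ 2) :
    ∃ D : Finset ℂ, #D = n ∧ energy r₀ v₂ v₃ D ≤ ((R - 2 * n : ℝ) : EReal) := by
  rcases Nat.eq_zero_or_pos n with rfl | hn
  · exact ⟨∅, rfl, by simp [energy]⟩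
  have fits := le_half_mul_half hR
  have hb : 0 < R - R / 2 := Nat.pos_of_ne_zero fun h => by simp [h] at fits; omega
  refine ⟨(rowFilling n (R - R / 2)).image latticePoint, ?_, ?_⟩
  · rw [Finset.card_image_of_injective _ latticePoint_injective, card_rowFilling]
  · rw [H.energy_eq_coe (H.finitePairs_lattice _), EReal.coe_le_coe_iff, H.realEnergy_lattice]
    have bonds := two_mul_le_bonds_rowFilling hb fits
    rw [Nat.add_sub_of_le (R.div_le_self 2)] at bonds
    have : (2 * n : ℝ) ≤ (#(bondsAlong (rowFilling n (R - R / 2)) (-1, 0)) +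
        #(bondsAlong (rowFilling n (R - R / 2)) (0, -1)) : ℕ) + R := by exact_mod_cast bonds
    linarith

end Admissible

/-! ### Ground states -/

theorem neighbors_symm {r₀ : ℝ} {C : Finset ℂ} {x y : ℂ} (hx : x ∈ C)
    (hy : y ∈ neighbors r₀ C x) : x ∈ neighbors r₀ C y := by
  obtain ⟨hne, -, hd⟩ := mem_neighbors.1 hy
  exact mem_neighbors.2 ⟨hne.symm, hx, dist_comm x y ▸ hd⟩

theorem realEnergy_singleton (r₀ : ℝ) (v₂ : ℝ → EReal) (v₃ : ℝ → ℝ) (x : ℂ) :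
    realEnergy r₀ v₂ v₃ {x} = 0 := by
  simp [realEnergy, siteEnergy, pairEnergy, angleEnergy, neighbors]

theorem exists_forall_lt_dist (r : ℝ) (C : Finset ℂ) : ∃ p, ∀ y ∈ C, r < dist y p :=
  ((Finset.eventually_all C).2 fun y _ =>
    (Metric.tendsto_dist_left_cobounded_atTop y).eventually_gt_atTop r).exists

theorem dist_le_half_of_floor_eq {y z : ℂ} (hre : ⌊3 * y.re⌋ = ⌊3 * z.re⌋)
    (him : ⌊3 * y.im⌋ = ⌊3 * z.im⌋) : dist y z ≤ 1 / 2 := by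
  obtain ⟨re_lower, re_upper⟩ := abs_lt.1 (Int.abs_sub_lt_one_of_floor_eq_floor hre)
  obtain ⟨im_lower, im_upper⟩ := abs_lt.1 (Int.abs_sub_lt_one_of_floor_eq_floor him)
  have re_sq : (y.re - z.re) ^ 2 ≤ (1 / 3) ^ 2 := sq_le_sq' (by linarith) (by linarith)
  have im_sq : (y.im - z.im) ^ 2 ≤ (1 / 3) ^ 2 := sq_le_sq' (by linarith) (by linarith)
  refine le_of_sq_le_sq ?_ (by norm_num)
  rw [Complex.dist_eq, Complex.sq_norm, Complex.normSq_apply, Complex.sub_re, Complex.sub_im]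
  linarith

theorem floor_three_mul_mem_Icc {a : ℝ} (ha : |a| ≤ 3 / 2) : ⌊3 * a⌋ ∈ Finset.Icc (-5 : ℤ) 5 := by
  obtain ⟨lower, upper⟩ := abs_le.1 ha
  refine Finset.mem_Icc.2 ⟨Int.le_floor.2 ?_, Int.lt_add_one_iff.1 (Int.floor_lt.2 ?_)⟩ <;>
    push_cast <;> linarith

-- The disc is covered by `11 ^ 2` squares of diameter less than `1 / 2`.
theorem card_neighbors_le {C : Finset ℂ} {r s : ℝ} {k : ℕ} (hr : r ≤ 3 / 2) (hs : 1 / 2 ≤ s)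
    (hk : ∀ y ∈ C, #(neighbors s C y) ≤ k) (x : ℂ) :
    #(neighbors r C x) ≤ (k + 1) * 121 := by
  classical
  let cell : ℂ → ℤ × ℤ := fun y => (⌊3 * (y - x).re⌋, ⌊3 * (y - x).im⌋)
  have cells : (neighbors r C x).image cell ⊆ Finset.Icc (-5 : ℤ) 5 ×ˢ Finset.Icc (-5 : ℤ) 5 := by
    refine Finset.image_subset_iff.2 fun y hy => ?_
    have near : ‖y - x‖ ≤ 3 / 2 := by
      rw [← dist_eq_norm, dist_comm]
      exact (mem_neighbors.1 hy).2.2.trans hr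
    exact Finset.mem_product.2
      ⟨floor_three_mul_mem_Icc ((Complex.abs_re_le_norm _).trans near),
        floor_three_mul_mem_Icc ((Complex.abs_im_le_norm _).trans near)⟩
  have card_cell : ∀ q ∈ (neighbors r C x).image cell,
      #{z ∈ neighbors r C x | cell z = q} ≤ k + 1 := by
    intro q hq
    obtain ⟨y, hy, rfl⟩ := Finset.mem_image.1 hq
    have subset : {z ∈ neighbors r C x | cell z = cell y} ⊆ insert y (neighbors s C y) := by
      intro z hz
      obtain ⟨hz, hcell⟩ := Finset.mem_filter.1 hz
      obtain ⟨hre, him⟩ := Prod.mk.inj hcell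
      have := dist_le_half_of_floor_eq hre.symm him.symm
      rw [dist_sub_right] at this
      rw [Finset.mem_insert, mem_neighbors]
      exact or_iff_not_imp_left.2 fun hne =>
        ⟨hne, (mem_neighbors.1 hz).2.1, this.trans hs⟩
    exact (Finset.card_le_card subset).trans ((Finset.card_insert_le _ _).trans
      (Nat.add_le_add_right (hk y (mem_neighbors.1 hy).2.1) 1))
  exact (Finset.card_le_mul_card_image _ _ card_cell).trans
    (Nat.mul_le_mul_left _ (Finset.card_le_card cells))

theorem card_mul_sq_le_of_separated {N : Finset ℂ} {x : ℂ} {r ρ : ℝ} (hρ : 0 < ρ) (hr : 0 ≤ r)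
    (hN : ∀ y ∈ N, dist x y ≤ r) (hsep : ∀ y ∈ N, ∀ z ∈ N, y ≠ z → 2 * ρ ≤ dist y z) :
    #N * ρ ^ 2 ≤ (r + ρ) ^ 2 := by
  have disjoint : (N : Set ℂ).PairwiseDisjoint fun y => Metric.ball y ρ :=
    fun y hy z hz hyz => Metric.ball_disjoint_ball (by linarith [hsep y hy z hz hyz])
  have subset : (⋃ y ∈ N, Metric.ball y ρ) ⊆ Metric.ball x (r + ρ) := by
    refine Set.iUnion₂_subset fun y hy => Metric.ball_subset_ball' ?_
    rw [dist_comm]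
    linarith [hN y hy]
  have area := MeasureTheory.measure_mono (μ := MeasureTheory.volume) subset
  rw [MeasureTheory.measure_biUnion_finset disjoint fun _ _ => measurableSet_ball] at area
  simp only [Complex.volume_ball, Finset.sum_const, nsmul_eq_mul] at area
  rw [← mul_assoc, ENNReal.mul_le_mul_iff_left (by simpa using NNReal.pi_pos.ne')
    ENNReal.coe_ne_top, ← ENNReal.ofReal_pow hρ.le, ← ENNReal.ofReal_pow (by positivity),
    ← ENNReal.ofReal_natCast, ← ENNReal.ofReal_mul (by positivity),
    ENNReal.ofReal_le_ofReal_iff (by positivity)] at area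
  exact area

namespace Admissible

variable {ε r₀ : ℝ} {v₂ : ℝ → EReal} {v₃ : ℝ → ℝ}

variable (H : Admissible ε r₀ v₂ v₃)
include H

theorem r₀_lt_three_halves : r₀ < 3 / 2 :=
  H.r₀_lt.trans (by rw [Real.sqrt_lt' (by norm_num)]; norm_num)

theorem pairEnergy_eq_sum_neighbors (C : Finset ℂ) (x : ℂ) :
    pairEnergy v₂ C x = ∑ y ∈ neighbors r₀ C x, (v₂ (dist x y)).toReal := by
  rw [pairEnergy, neighbors, Finset.sum_filter]
  refine Finset.sum_congr rfl fun y _ => ?_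
  split_ifs with h
  · rfl
  · exact H.toReal_eq_zero (not_le.1 h).le

theorem card_mul_inv_sub_card_le_pairEnergy (hε : 0 < ε) {C : Finset ℂ}
    (hC : FinitePairs v₂ C) {x : ℂ} (hx : x ∈ C) :
    #(neighbors (1 - ε) C x) * ε⁻¹ - #(neighbors r₀ C x) ≤ pairEnergy v₂ C x := by
  have value : ∀ y ∈ C.erase x, (if dist x y ≤ 1 - ε then 1 else 0) * ε⁻¹ -
      (if dist x y ≤ r₀ then 1 else 0) ≤ (v₂ (dist x y)).toReal := by
    intro y hy
    obtain ⟨hne, hy⟩ := Finset.mem_erase.1 hy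
    have finite := hC x hx y hy hne.symm
    have := H.one_lt_r₀
    by_cases near : dist x y ≤ 1 - ε
    · have repulsion := H.repulsion₂ _ dist_nonneg near
      rw [← EReal.coe_toReal finite (H.v₂_ne_bot dist_nonneg),
        EReal.coe_lt_coe_iff] at repulsion
      rw [if_pos near, if_pos (by linarith)]
      linarith
    · rw [if_neg near, zero_mul, zero_sub]
      split_ifs with bond
      · exact H.neg_one_le_toReal dist_nonneg finite
      · rw [H.toReal_eq_zero (not_le.1 bond).le, neg_zero]
  have sum_le := Finset.sum_le_sum value
  rwa [Finset.sum_sub_distrib, ← Finset.sum_mul, Finset.sum_boole, Finset.sum_boole] at sum_le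

theorem finitePairs_union {A B : Finset ℂ} (hA : FinitePairs v₂ A) (hB : FinitePairs v₂ B)
    (hAB : ∀ x ∈ A, ∀ y ∈ B, r₀ < dist x y) : FinitePairs v₂ (A ∪ B) := by
  have apart : ∀ {r}, r₀ < r → v₂ r ≠ ⊤ := fun hr => by
    rw [H.cutoff₂ _ hr.le]
    exact EReal.zero_ne_top
  intro x hx y hy hxy
  rcases Finset.mem_union.1 hx with hx | hx <;> rcases Finset.mem_union.1 hy with hy | hy
  · exact hA x hx y hy hxy
  · exact apart (hAB x hx y hy)
  · exact apart (dist_comm x y ▸ hAB y hy x hx)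
  · exact hB x hx y hy hxy

end Admissible

namespace IsGroundState

variable {ε r₀ : ℝ} {v₂ : ℝ → EReal} {v₃ : ℝ → ℝ} {n : ℕ} {C : Finset ℂ}

variable (hG : IsGroundState r₀ v₂ v₃ n C) (H : Admissible ε r₀ v₂ v₃)
include hG H

theorem finitePairs : FinitePairs v₂ C := by
  obtain ⟨D, hD, hE⟩ := H.exists_energy_le (n := n) (R := 2 * (n + 1)) (by nlinarith)
  exact H.finitePairs_of_energy_ne_top
    (ne_top_of_le_ne_top (EReal.coe_ne_top _) ((hG.2 D hD).trans hE))

theorem realEnergy_le {R : ℕ} (hR : 4 * n ≤ R ^ 2) : realEnergy r₀ v₂ v₃ C ≤ R - 2 * n := by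
  obtain ⟨D, hD, hE⟩ := H.exists_energy_le hR
  have := (hG.2 D hD).trans hE
  rwa [H.energy_eq_coe (hG.finitePairs H), EReal.coe_le_coe_iff] at this

-- Moving `x` far away from all other particles does not lower the energy.
theorem realEnergy_le_erase {x : ℂ} (hx : x ∈ C) :
    realEnergy r₀ v₂ v₃ C ≤ realEnergy r₀ v₂ v₃ (C.erase x) := by
  obtain ⟨p, hp⟩ := exists_forall_lt_dist r₀ (C.erase x)
  have far : ∀ y ∈ C.erase x, ∀ z ∈ ({p} : Finset ℂ), r₀ < dist y z := fun y hy z hz =>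
    Finset.mem_singleton.1 hz ▸ hp y hy
  have p_notMem : p ∉ C.erase x := fun h => by
    have := hp p h
    rw [dist_self] at this
    linarith [H.one_lt_r₀]
  have card : #(C.erase x ∪ {p}) = n := by
    rw [Finset.card_union_of_disjoint (Finset.disjoint_singleton_right.2 p_notMem),
      Finset.card_singleton, Finset.card_erase_add_one hx, hG.1]
  have finite : FinitePairs v₂ (C.erase x ∪ {p}) := by
    refine H.finitePairs_union (fun y hy z hz => hG.finitePairs H y (Finset.mem_of_mem_erase hy)
      z (Finset.mem_of_mem_erase hz)) (fun y hy z hz hyz => absurd ?_ hyz) far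
    rw [Finset.mem_singleton.1 hy, Finset.mem_singleton.1 hz]
  have minimal := hG.2 _ card
  rwa [H.energy_eq_coe (hG.finitePairs H), H.energy_eq_coe finite, EReal.coe_le_coe_iff,
    H.realEnergy_union far, realEnergy_singleton, add_zero] at minimal

theorem pairEnergy_add_angleEnergy_nonpos {x : ℂ} (hx : x ∈ C) :
    pairEnergy v₂ C x + 1 / 2 * angleEnergy r₀ v₃ C x ≤ 0 := by
  have insert_ge := H.realEnergy_add_le_realEnergy_insert (Finset.notMem_erase x C)
  rw [Finset.insert_erase hx] at insert_ge
  linarith [hG.realEnergy_le_erase H hx]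

-- At a particle with a maximal number `k` of others within distance `1 - ε`, the repulsion
-- `k / ε` would exceed the attraction by the at most `121 * (k + 1)` bonded particles.
theorem lt_dist (hε : 0 < ε) (hε' : ε < 1 / 1000) {x y : ℂ} (hx : x ∈ C) (hy : y ∈ C)
    (hxy : x ≠ y) : 1 - ε < dist x y := by
  by_contra! near
  obtain ⟨m, hm, hmax⟩ := Finset.exists_max_image C (fun z => #(neighbors (1 - ε) C z)) ⟨x, hx⟩
  set k := #(neighbors (1 - ε) C m)
  have one_le_k : (1 : ℝ) ≤ k := by
    exact_mod_cast (Finset.card_pos.2 ⟨y, mem_neighbors.2 ⟨hxy.symm, hy, near⟩⟩).trans_le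
      (hmax x hx)
  have card_bonds : (#(neighbors r₀ C m) : ℝ) ≤ (k + 1) * 121 := by
    exact_mod_cast card_neighbors_le H.r₀_lt_three_halves.le (by linarith) hmax m
  have pair_ge : k * ε⁻¹ - #(neighbors r₀ C m) ≤ pairEnergy v₂ C m :=
    H.card_mul_inv_sub_card_le_pairEnergy hε (hG.finitePairs H) hm
  have site_nonpos := hG.pairEnergy_add_angleEnergy_nonpos H hm
  have angle_nonneg := H.angleEnergy_nonneg C m
  have repulsion : (k : ℝ) * 1000 ≤ k * ε⁻¹ := by
    gcongr
    rw [le_inv_comm₀ (by norm_num) hε]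
    linarith
  linarith

end IsGroundState

/-- All bond angles of `C` are within `ε` of a right angle, a straight angle or three right
angles. -/
def NearlyRightAngles (ε r₀ : ℝ) (C : Finset ℂ) : Prop :=
  ∀ x ∈ C, ∀ y ∈ neighbors r₀ C x, ∀ z ∈ neighbors r₀ C x, y ≠ z →
    ∃ j ∈ Finset.Icc (1 : ℤ) 3, |cwAngle (y - x) (z - x) - j * (π / 2)| ≤ ε

theorem NearlyRightAngles.subset {ε r₀ : ℝ} {A C : Finset ℂ} (h : NearlyRightAngles ε r₀ C)
    (hA : A ⊆ C) : NearlyRightAngles ε r₀ A := fun x hx y hy z hz hyz =>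
  h x (hA hx) y (neighbors_mono hA x hy) z (neighbors_mono hA x hz) hyz

namespace Admissible

variable {ε r₀ : ℝ} {v₂ : ℝ → EReal} {v₃ : ℝ → ℝ}

variable (H : Admissible ε r₀ v₂ v₃)
include H

theorem v₃_cwAngle_comm (u w : ℂ) : v₃ (cwAngle w u) = v₃ (cwAngle u w) := by
  rcases cwAngle_swap u w with h | h <;> rw [h]
  exact (H.symm₃ _ (cwAngle_mem_Icc u w)).symm

theorem exists_abs_cwAngle_sub_le_or_lt_v₃ (u w : ℂ) :
    (∃ j ∈ Finset.Icc (1 : ℤ) 3, |cwAngle u w - j * (π / 2)| ≤ ε) ∨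
      4 / (1 - ε) ^ 2 * (√2 + 1 / 2) ^ 2 < v₃ (cwAngle u w) := by
  refine or_iff_not_imp_left.2 fun h => H.large₃ _ (cwAngle_mem_Icc u w) ?_ ?_ ?_ <;>
    refine fun hmem => h ?_
  · exact ⟨1, by decide, abs_le.2 (by push_cast; constructor <;> linarith [hmem.1, hmem.2])⟩
  · exact ⟨2, by decide, abs_le.2 (by push_cast; constructor <;> linarith [hmem.1, hmem.2])⟩
  · exact ⟨3, by decide, abs_le.2 (by push_cast; constructor <;> linarith [hmem.1, hmem.2])⟩

theorem two_mul_v₃_le_angleEnergy {C : Finset ℂ} {x y z : ℂ} (hy : y ∈ neighbors r₀ C x)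
    (hz : z ∈ neighbors r₀ C x) (hyz : y ≠ z) :
    2 * v₃ (cwAngle (y - x) (z - x)) ≤ angleEnergy r₀ v₃ C x := by
  let row : ℂ → ℝ := fun y => ∑ z ∈ (neighbors r₀ C x).erase y, v₃ (cwAngle (y - x) (z - x))
  have le_row : ∀ y, ∀ z ∈ (neighbors r₀ C x).erase y, v₃ (cwAngle (y - x) (z - x)) ≤ row y :=
    fun y _ hz => Finset.single_le_sum (f := fun z => v₃ (cwAngle (y - x) (z - x)))
      (fun _ _ => H.v₃_nonneg _ _) hz
  calc 2 * v₃ (cwAngle (y - x) (z - x))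
      = v₃ (cwAngle (y - x) (z - x)) + v₃ (cwAngle (z - x) (y - x)) := by
        rw [H.v₃_cwAngle_comm (y - x) (z - x), two_mul]
    _ ≤ row y + row z := add_le_add (le_row y z (Finset.mem_erase.2 ⟨hyz.symm, hz⟩))
        (le_row z y (Finset.mem_erase.2 ⟨hyz, hy⟩))
    _ ≤ angleEnergy r₀ v₃ C x := Finset.add_le_sum (f := row)
        (fun _ _ => Finset.sum_nonneg fun _ _ => H.v₃_nonneg _ _) hy hz hyz

end Admissible

namespace IsGroundState

variable {ε r₀ : ℝ} {v₂ : ℝ → EReal} {v₃ : ℝ → ℝ} {n : ℕ} {C : Finset ℂ}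

variable (hG : IsGroundState r₀ v₂ v₃ n C) (H : Admissible ε r₀ v₂ v₃) (hε : 0 < ε)
  (hε' : ε < 1 / 1000)
include hG H hε hε'

theorem card_neighbors_le {x : ℂ} :
    #(neighbors r₀ C x) ≤ 4 / (1 - ε) ^ 2 * (√2 + 1 / 2) ^ 2 := by
  have half_pos : 0 < (1 - ε) / 2 := by linarith
  have := H.one_lt_r₀
  have discs : #(neighbors r₀ C x) * ((1 - ε) / 2) ^ 2 ≤ (r₀ + (1 - ε) / 2) ^ 2 := by
    refine card_mul_sq_le_of_separated half_pos (by linarith)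
      (fun y hy => (mem_neighbors.1 hy).2.2) fun y hy z hz hyz => ?_
    linarith [hG.lt_dist H hε hε' (mem_neighbors.1 hy).2.1 (mem_neighbors.1 hz).2.1 hyz]
  have radius : (r₀ + (1 - ε) / 2) ^ 2 ≤ (√2 + 1 / 2) ^ 2 := by
    gcongr
    · exact H.r₀_lt.le
    · linarith
  calc (#(neighbors r₀ C x) : ℝ) ≤ (√2 + 1 / 2) ^ 2 / ((1 - ε) / 2) ^ 2 :=
        (le_div_iff₀ (by positivity)).2 (discs.trans radius)
    _ = 4 / (1 - ε) ^ 2 * (√2 + 1 / 2) ^ 2 := by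
        rw [div_pow]
        field_simp
        norm_num

-- A bad angle costs more than the deletion of all bonds at its vertex.
theorem nearlyRightAngles : NearlyRightAngles ε r₀ C := by
  intro x hx y hy z hz hyz
  refine (H.exists_abs_cwAngle_sub_le_or_lt_v₃ _ _).resolve_right fun large => ?_
  have two_v₃ := H.two_mul_v₃_le_angleEnergy hy hz hyz
  have card_le := hG.card_neighbors_le H hε hε' (x := x)
  have pair_ge := H.card_mul_inv_sub_card_le_pairEnergy hε (hG.finitePairs H) hx
  have : 0 ≤ #(neighbors (1 - ε) C x) * ε⁻¹ := by positivity
  linarith [hG.pairEnergy_add_angleEnergy_nonpos H hx]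

end IsGroundState

theorem quarter_eq_of_abs_sub_le {u w : ℂ} {m : ℤ}
    (h : |arg u - arg w - m * (π / 2)| ≤ 1 / 100) : quarter u w = m := by
  have right_pos := Real.pi_div_two_pos
  have split : (arg u - arg w) / (π / 2) =
      m + (arg u - arg w - m * (π / 2)) / (π / 2) := by field_simp; ring
  have small : |(arg u - arg w - m * (π / 2)) / (π / 2)| < 1 / 2 := by
    rw [abs_div, abs_of_pos right_pos, div_lt_iff₀ right_pos]
    linarith [Real.pi_gt_three]
  obtain ⟨lower, upper⟩ := abs_lt.1 small
  rw [quarter, round_eq, Int.floor_eq_iff, split]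
  constructor <;> linarith

theorem deviation_of_cwAngle {u w : ℂ} (hu : u ≠ 0) (hw : w ≠ 0) {j : ℤ}
    (h : |cwAngle u w - j * (π / 2)| ≤ 1 / 100) :
    quarter u w % 4 = j % 4 ∧ deviation u w = cwAngle u w - j * (π / 2) := by
  obtain ⟨k, hk⟩ := exists_cwAngle_eq hu hw
  have rest : arg u - arg w - ((j - 4 * k : ℤ) : ℝ) * (π / 2) = cwAngle u w - j * (π / 2) := by
    rw [hk]
    push_cast
    ring
  have quarter_eq : quarter u w = j - 4 * k := quarter_eq_of_abs_sub_le (by rwa [rest])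
  exact ⟨by omega, by rw [deviation, quarter_eq, rest]⟩

/-- The graph on the particles of `C` whose edges are the bonds. -/
def bondGraph (r₀ : ℝ) (C : Finset ℂ) : SimpleGraph C where
  Adj x y := (y : ℂ) ∈ neighbors r₀ C x
  symm := ⟨fun x _ h => neighbors_symm x.2 h⟩
  loopless := ⟨fun _ h => (mem_neighbors.1 h).1 rfl⟩

instance (r₀ : ℝ) (C : Finset ℂ) : DecidableRel (bondGraph r₀ C).Adj :=
  fun x y => inferInstanceAs (Decidable ((y : ℂ) ∈ neighbors r₀ C x))

theorem degree_bondGraph (r₀ : ℝ) (C : Finset ℂ) (x : C) :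
    (bondGraph r₀ C).degree x = #(neighbors r₀ C x) := by
  rw [← SimpleGraph.card_neighborFinset_eq_degree, ← Finset.card_map (Function.Embedding.subtype _)]
  congr 1
  ext y
  simp only [Finset.mem_map, SimpleGraph.mem_neighborFinset, Function.Embedding.subtype_apply]
  exact ⟨fun ⟨_, h, hy⟩ => hy ▸ h, fun h => ⟨⟨y, (mem_neighbors.1 h).2.1⟩, h, rfl⟩⟩

theorem two_mul_card_edgeFinset_bondGraph (r₀ : ℝ) (C : Finset ℂ) :
    2 * #(bondGraph r₀ C).edgeFinset = ∑ x ∈ C, #(neighbors r₀ C x) := by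
  rw [← SimpleGraph.sum_degrees_eq_twice_card_edges, ← Finset.sum_coe_sort C]
  exact Finset.sum_congr rfl fun x _ => degree_bondGraph r₀ C x

theorem angleEnergy_eq_sum_ite (r₀ : ℝ) (v₃ : ℝ → ℝ) (C : Finset ℂ) (x : ℂ) :
    angleEnergy r₀ v₃ C x = ∑ y ∈ C, ∑ z ∈ C,
      if y ∈ neighbors r₀ C x ∧ z ∈ neighbors r₀ C x ∧ z ≠ y then
        v₃ (cwAngle (y - x) (z - x)) else 0 := by
  have subset : neighbors r₀ C x ⊆ C := fun y hy => (mem_neighbors.1 hy).2.1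
  have others : ∀ y, (neighbors r₀ C x).erase y = {z ∈ C | z ∈ neighbors r₀ C x ∧ z ≠ y} := by
    intro y
    ext z
    grind
  rw [angleEnergy, ← Finset.inter_eq_right.2 subset, ← Finset.filter_mem_eq_inter,
    Finset.sum_filter]
  refine Finset.sum_congr rfl fun y _ => ?_
  rw [Finset.filter_mem_eq_inter, Finset.inter_eq_right.2 subset, others, Finset.sum_filter]
  split_ifs with hy <;> simp [hy]

namespace NearlyRightAngles

variable {ε r₀ : ℝ} {C : Finset ℂ}

variable (hC : NearlyRightAngles ε r₀ C) (hε : ε < 1 / 1000)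
include hC hε

theorem exists_deviation_eq {x y z : ℂ} (hx : x ∈ C) (hy : y ∈ neighbors r₀ C x)
    (hz : z ∈ neighbors r₀ C x) (hyz : y ≠ z) : ∃ j ∈ Finset.Icc (1 : ℤ) 3,
      |deviation (y - x) (z - x)| ≤ ε ∧ quarter (y - x) (z - x) % 4 = j ∧
        deviation (y - x) (z - x) = cwAngle (y - x) (z - x) - j * (π / 2) := by
  obtain ⟨j, hj, near⟩ := hC x hx y hy z hz hyz
  obtain ⟨hq, hdev⟩ := deviation_of_cwAngle (sub_ne_zero.2 (mem_neighbors.1 hy).1)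
    (sub_ne_zero.2 (mem_neighbors.1 hz).1) (near.trans (by linarith))
  obtain ⟨lower, upper⟩ := Finset.mem_Icc.1 hj
  exact ⟨j, hj, hdev ▸ near, by omega, hdev⟩

theorem regularAngles_bondGraph : RegularAngles (bondGraph r₀ C) Subtype.val := by
  intro x y z hy hz hyz
  obtain ⟨j, hj, small, hq, -⟩ :=
    hC.exists_deviation_eq hε x.2 hy hz (Subtype.coe_injective.ne hyz)
  have := (Finset.mem_Icc.1 hj).1
  exact ⟨small.trans (by linarith), by omega⟩

variable {v₂ : ℝ → EReal} {v₃ : ℝ → ℝ} (H : Admissible ε r₀ v₂ v₃)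
include H

theorem abs_deviation_le_v₃ {x y z : ℂ} (hx : x ∈ C) (hy : y ∈ neighbors r₀ C x)
    (hz : z ∈ neighbors r₀ C x) (hzy : z ≠ y) (straight : quarter (y - x) (z - x) % 4 = 2) :
    24 / π * |deviation (y - x) (z - x)| ≤ v₃ (cwAngle (y - x) (z - x)) := by
  obtain ⟨j, -, small, rfl, hdev⟩ := hC.exists_deviation_eq hε hx hy hz hzy.symm
  rw [straight, Int.cast_two, mul_div_cancel₀ _ two_ne_zero] at hdev
  rw [hdev] at small ⊢
  obtain ⟨lower, upper⟩ := abs_le.1 small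
  have := Real.pi_gt_three
  calc 24 / π * |cwAngle (y - x) (z - x) - π|
      ≤ 4 * (π / 6 - ε)⁻¹ * |cwAngle (y - x) (z - x) - π| := by
        gcongr
        rw [← div_eq_mul_inv, div_le_div_iff₀ (by linarith) (by linarith)]
        linarith
    _ ≤ v₃ (cwAngle (y - x) (z - x)) := (H.slope₃ _ ⟨by linarith, by linarith⟩).1

theorem sum_straightAngles_le : ∑ t ∈ straightAngles (bondGraph r₀ C) Subtype.val,
    24 / π * |deviation (t.2.1 - t.1 : ℂ) (t.2.2 - t.1)| ≤ ∑ x ∈ C, angleEnergy r₀ v₃ C x := by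
  rw [straightAngles, Finset.sum_filter]
  simp only [Fintype.sum_prod_type, angleEnergy_eq_sum_ite, ← Finset.sum_coe_sort C]
  refine Finset.sum_le_sum fun x _ => Finset.sum_le_sum fun y _ => Finset.sum_le_sum fun z _ => ?_
  split_ifs with straight bonds
  · obtain ⟨hy, hz, hzy, hq⟩ := straight
    exact hC.abs_deviation_le_v₃ hε H x.2 hy hz (Subtype.coe_injective.ne hzy) hq
  · exact absurd ⟨straight.1, straight.2.1, Subtype.coe_injective.ne straight.2.2.1⟩ bonds
  · exact H.v₃_nonneg _ _
  · rfl

end NearlyRightAngles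

/-- The part of the energy at `x` which the ground states minimize to zero: the excess of the pair
energy of the bonds at `x` over its minimum, and a share of the angle energy. -/
def defect (r₀ : ℝ) (v₂ : ℝ → EReal) (v₃ : ℝ → ℝ) (C : Finset ℂ) (x : ℂ) : ℝ :=
  1 / 2 * ∑ y ∈ neighbors r₀ C x, (1 + (v₂ (dist x y)).toReal) + 1 / 6 * angleEnergy r₀ v₃ C x

theorem add_sub_one_sq_ge {a b R S : ℕ} (ha : 0 < a) (hb : 0 < b) (hR : 4 * a ≤ R ^ 2)
    (hS : 4 * b ≤ S ^ 2) : 4 * (a + b) ≤ (R + S - 1) ^ 2 := by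
  obtain ⟨r, rfl⟩ := Nat.exists_eq_add_of_le (show 2 ≤ R by nlinarith)
  obtain ⟨s, rfl⟩ := Nat.exists_eq_add_of_le (show 2 ≤ S by nlinarith)
  rw [show 2 + r + (2 + s) - 1 = 3 + r + s by omega]
  nlinarith [Nat.zero_le (r * s)]

namespace Admissible

variable {ε r₀ : ℝ} {v₂ : ℝ → EReal} {v₃ : ℝ → ℝ}

variable (H : Admissible ε r₀ v₂ v₃)
include H

theorem bondExcess_nonneg {C : Finset ℂ} (hC : FinitePairs v₂ C) {x y : ℂ} (hx : x ∈ C)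
    (hy : y ∈ neighbors r₀ C x) : 0 ≤ 1 + (v₂ (dist x y)).toReal := by
  obtain ⟨hne, hy, -⟩ := mem_neighbors.1 hy
  linarith [H.neg_one_le_toReal dist_nonneg (hC x hx y hy hne.symm)]

theorem defect_nonneg {C : Finset ℂ} (hC : FinitePairs v₂ C) {x : ℂ} (hx : x ∈ C) :
    0 ≤ defect r₀ v₂ v₃ C x :=
  add_nonneg (mul_nonneg (by norm_num) (Finset.sum_nonneg fun _ => H.bondExcess_nonneg hC hx))
    (mul_nonneg (by norm_num) (H.angleEnergy_nonneg C x))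

theorem toReal_eq_neg_one_of_defect_eq_zero {C : Finset ℂ} (hC : FinitePairs v₂ C) {x y : ℂ}
    (hx : x ∈ C) (hy : y ∈ neighbors r₀ C x) (h : defect r₀ v₂ v₃ C x = 0) :
    (v₂ (dist x y)).toReal = -1 := by
  have excess_le := Finset.single_le_sum (fun _ => H.bondExcess_nonneg hC hx) hy
  have excess_nonneg := H.bondExcess_nonneg hC hx hy
  have angle_nonneg := H.angleEnergy_nonneg C x
  rw [defect] at h
  linarith

theorem angleEnergy_eq_zero_of_defect_eq_zero {C : Finset ℂ} (hC : FinitePairs v₂ C) {x : ℂ}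
    (hx : x ∈ C) (h : defect r₀ v₂ v₃ C x = 0) : angleEnergy r₀ v₃ C x = 0 := by
  have excess_nonneg := Finset.sum_nonneg fun _ => H.bondExcess_nonneg hC hx
  have angle_nonneg := H.angleEnergy_nonneg C x
  rw [defect] at h
  linarith

theorem sum_card_neighbors_add_realEnergy (C : Finset ℂ) :
    1 / 2 * ∑ x ∈ C, (#(neighbors r₀ C x) : ℝ) + realEnergy r₀ v₂ v₃ C =
      ∑ x ∈ C, defect r₀ v₂ v₃ C x + 1 / 3 * ∑ x ∈ C, angleEnergy r₀ v₃ C x := by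
  rw [realEnergy, Finset.mul_sum, Finset.mul_sum, ← Finset.sum_add_distrib,
    ← Finset.sum_add_distrib]
  refine Finset.sum_congr rfl fun x _ => ?_
  rw [siteEnergy, defect, H.pairEnergy_eq_sum_neighbors, Finset.sum_add_distrib, Finset.sum_const,
    nsmul_one]
  ring

theorem exists_chain_number_add_defect_le {C : Finset ℂ} (hε : ε < 1 / 1000)
    (hC : NearlyRightAngles ε r₀ C) : ∃ R : ℕ, 4 * #C ≤ R ^ 2 ∧
      R + ∑ x ∈ C, defect r₀ v₂ v₃ C x ≤ 2 * #C + realEnergy r₀ v₂ v₃ C := by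
  obtain ⟨R, hR, chains⟩ := (hC.regularAngles_bondGraph hε).exists_chain_number
    fun x y h => (mem_neighbors.1 h).1.symm
  rw [Fintype.card_coe] at hR chains
  have angles := hC.sum_straightAngles_le hε H
  rw [← Finset.mul_sum, show 24 / π = 3 * (8 / π) by ring, mul_assoc] at angles
  have edges : (2 * #(bondGraph r₀ C).edgeFinset : ℝ) = ∑ x ∈ C, (#(neighbors r₀ C x) : ℝ) := by
    exact_mod_cast two_mul_card_edgeFinset_bondGraph r₀ C
  exact ⟨R, hR, by linarith [H.sum_card_neighbors_add_realEnergy C]⟩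

theorem exists_chain_number_le {C : Finset ℂ} (hε : ε < 1 / 1000)
    (hC : NearlyRightAngles ε r₀ C) (hfin : FinitePairs v₂ C) :
    ∃ R : ℕ, 4 * #C ≤ R ^ 2 ∧ R ≤ 2 * #C + realEnergy r₀ v₂ v₃ C := by
  obtain ⟨R, hR, h⟩ := H.exists_chain_number_add_defect_le hε hC
  have := Finset.sum_nonneg fun x hx => H.defect_nonneg hfin (x := x) hx
  exact ⟨R, hR, by linarith⟩

end Admissible

namespace IsGroundState

variable {ε r₀ : ℝ} {v₂ : ℝ → EReal} {v₃ : ℝ → ℝ} {n : ℕ} {C : Finset ℂ}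

variable (hG : IsGroundState r₀ v₂ v₃ n C) (H : Admissible ε r₀ v₂ v₃) (hε : 0 < ε)
  (hε' : ε < 1 / 1000)
include hG H hε hε'

theorem defect_eq_zero {x : ℂ} (hx : x ∈ C) : defect r₀ v₂ v₃ C x = 0 := by
  obtain ⟨R, hR, lower⟩ :=
    H.exists_chain_number_add_defect_le hε' (hG.nearlyRightAngles H hε hε')
  rw [hG.1] at hR lower
  have upper := hG.realEnergy_le H hR
  have nonneg : ∀ y ∈ C, 0 ≤ defect r₀ v₂ v₃ C y := fun _ => H.defect_nonneg (hG.finitePairs H)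
  linarith [Finset.single_le_sum nonneg hx, nonneg x hx]

theorem dist_eq_one {x y : ℂ} (hx : x ∈ C) (hy : y ∈ neighbors r₀ C x) : dist x y = 1 := by
  have finite := hG.finitePairs H
  have energy := H.toReal_eq_neg_one_of_defect_eq_zero finite hx hy
    (hG.defect_eq_zero H hε hε' hx)
  obtain ⟨hne, hy, -⟩ := mem_neighbors.1 hy
  by_contra h
  exact (H.neg_one_lt_toReal dist_nonneg (finite x hx y hy hne.symm) h).ne' energy

theorem pow_four_eq {x y z : ℂ} (hx : x ∈ C) (hy : y ∈ neighbors r₀ C x)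
    (hz : z ∈ neighbors r₀ C x) : (y - x) ^ 4 = (z - x) ^ 4 := by
  rcases eq_or_ne y z with rfl | hyz
  · rfl
  have norm_eq : ∀ w ∈ neighbors r₀ C x, ‖w - x‖ = 1 := fun w hw => by
    rw [← dist_eq_norm, dist_comm, hG.dist_eq_one H hε hε' hx hw]
  have angle_zero := H.angleEnergy_eq_zero_of_defect_eq_zero (hG.finitePairs H) hx
    (hG.defect_eq_zero H hε hε' hx)
  have two_v₃ := H.two_mul_v₃_le_angleEnergy hy hz hyz
  have v₃_zero : v₃ (cwAngle (y - x) (z - x)) = 0 := by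
    linarith [H.v₃_nonneg (y - x) (z - x)]
  exact pow_four_eq_of_cwAngle (sub_ne_zero.2 (mem_neighbors.1 hz).1)
    ((norm_eq y hy).trans (norm_eq z hz).symm) ((H.v₃_eq_zero_iff _ _).1 v₃_zero)

-- For two components with chain numbers `R` and `S`, a single configuration with `R + S - 1`
-- chains has less energy.
theorem eq_of_neighbors_subset {A : Finset ℂ} (hA : A ⊆ C) (hne : A.Nonempty)
    (hclosed : ∀ x ∈ A, neighbors r₀ C x ⊆ A) : A = C := by
  by_contra hAC
  have rest_nonempty : (C \ A).Nonempty := Finset.sdiff_nonempty.2 fun h => hAC (hA.antisymm h)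
  have lower : ∀ B ⊆ C, ∃ R : ℕ, 4 * #B ≤ R ^ 2 ∧ R ≤ 2 * #B + realEnergy r₀ v₂ v₃ B :=
    fun B hB => H.exists_chain_number_le hε' ((hG.nearlyRightAngles H hε hε').subset hB)
      fun x hx y hy => hG.finitePairs H x (hB hx) y (hB hy)
  obtain ⟨R, hR, lower_A⟩ := lower A hA
  obtain ⟨S, hS, lower_rest⟩ := lower (C \ A) Finset.sdiff_subset
  have apart : ∀ x ∈ A, ∀ y ∈ C \ A, r₀ < dist x y := fun x hx y hy => by
    obtain ⟨hyC, hyA⟩ := Finset.mem_sdiff.1 hy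
    by_contra! bonded
    exact hyA (hclosed x hx (mem_neighbors.2 ⟨fun h => hyA (h ▸ hx), hyC, bonded⟩))
  have split := H.realEnergy_union apart
  rw [Finset.union_sdiff_of_subset hA] at split
  have card : #A + #(C \ A) = n := by
    rw [add_comm, Finset.card_sdiff_add_card_eq_card hA, hG.1]
  have upper := hG.realEnergy_le H (R := R + S - 1)
    (card ▸ add_sub_one_sq_ge hne.card_pos rest_nonempty.card_pos hR hS)
  have one_le : 1 ≤ R + S := by nlinarith [hne.card_pos]
  rw [Nat.cast_sub one_le, ← card] at upper
  push_cast at upper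
  linarith

end IsGroundState

/-! ### The shape of a ground state -/

/-- The square lattice through `x₀` generated by `u` and `u * I`, as the image of `ℤ²`. -/
def rotatedLattice (x₀ u : ℂ) (k : ℤ × ℤ) : ℂ := x₀ + u * latticePoint k

theorem rotatedLattice_injective (x₀ : ℂ) {u : ℂ} (hu : u ≠ 0) :
    Function.Injective (rotatedLattice x₀ u) := fun _ _ h =>
  latticePoint_injective (mul_left_cancel₀ hu (add_left_cancel h))

theorem rotatedLattice_add (x₀ u : ℂ) (p e : ℤ × ℤ) :
    rotatedLattice x₀ u (p + e) = rotatedLattice x₀ u p + u * latticePoint e := by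
  rw [rotatedLattice, rotatedLattice, map_add, mul_add, add_assoc]

theorem dist_rotatedLattice (x₀ : ℂ) {u : ℂ} (hu : ‖u‖ = 1) (p q : ℤ × ℤ) :
    dist (rotatedLattice x₀ u p) (rotatedLattice x₀ u q) = ‖latticePoint (q - p)‖ := by
  rw [rotatedLattice, rotatedLattice, dist_add_left, dist_comm, dist_eq_norm, ← mul_sub, norm_mul,
    hu, one_mul, map_sub]

namespace Admissible

variable {ε r₀ : ℝ} {v₂ : ℝ → EReal} {v₃ : ℝ → ℝ} {C : Finset ℂ} {x₀ u : ℂ}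

variable (H : Admissible ε r₀ v₂ v₃) (hu : ‖u‖ = 1)
include H hu

theorem sub_mem_unitSteps_of_mem_neighbors {p q : ℤ × ℤ}
    (h : rotatedLattice x₀ u q ∈ neighbors r₀ C (rotatedLattice x₀ u p)) :
    q - p ∈ unitSteps := by
  obtain ⟨hne, -, hd⟩ := mem_neighbors.1 h
  rw [dist_rotatedLattice x₀ hu] at hd
  by_contra hqp
  have := sqrt_two_le_norm_latticePoint (sub_ne_zero.2 fun h => hne (congrArg _ h)) hqp
  linarith [H.r₀_lt]

theorem sum_card_neighbors_le {P : Finset (ℤ × ℤ)} (hC : C = P.image (rotatedLattice x₀ u)) :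
    ∑ x ∈ C, #(neighbors r₀ C x) ≤
      2 * (#(bondsAlong P (-1, 0)) + #(bondsAlong P (0, -1))) := by
  have injective := rotatedLattice_injective x₀ (norm_ne_zero_iff.1 (hu ▸ one_ne_zero))
  have neighbors_subset : ∀ p, neighbors r₀ C (rotatedLattice x₀ u p) ⊆
      {e ∈ unitSteps | p + e ∈ P}.image fun e => rotatedLattice x₀ u (p + e) := by
    intro p y hy
    obtain ⟨q, hq, rfl⟩ := Finset.mem_image.1 (hC ▸ (mem_neighbors.1 hy).2.1)
    exact Finset.mem_image.2 ⟨q - p, Finset.mem_filter.2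
      ⟨H.sub_mem_unitSteps_of_mem_neighbors hu hy, by rwa [add_sub_cancel]⟩,
      by rw [add_sub_cancel]⟩
  calc ∑ x ∈ C, #(neighbors r₀ C x)
      = ∑ p ∈ P, #(neighbors r₀ C (rotatedLattice x₀ u p)) := by
        conv_lhs => rw [hC, Finset.sum_image injective.injOn, ← hC]
    _ ≤ ∑ p ∈ P, #{e ∈ unitSteps | p + e ∈ P} := Finset.sum_le_sum fun p _ =>
        (Finset.card_le_card (neighbors_subset p)).trans Finset.card_image_le
    _ = _ := sum_card_unitSteps P

end Admissible

theorem exists_subset_Icc_of_ordConnected {J : Finset ℤ} (hne : J.Nonempty)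
    (h : (J : Set ℤ).OrdConnected) : ∃ l : ℤ, J ⊆ Finset.Icc (l + 1) (l + #J) := by
  have interval : Finset.Icc (J.min' hne) (J.max' hne) ⊆ J := by
    rw [← Finset.coe_subset, Finset.coe_Icc]
    exact h.out (J.min'_mem hne) (J.max'_mem hne)
  have card := Finset.card_le_card interval
  rw [Int.card_Icc] at card
  refine ⟨J.min' hne - 1, fun j hj => ?_⟩
  have min_le := J.min'_le j hj
  have le_max := J.le_max' j hj
  rw [Finset.mem_Icc]
  omega

namespace IsGroundState

variable {ε r₀ : ℝ} {v₂ : ℝ → EReal} {v₃ : ℝ → ℝ} {n : ℕ} {C : Finset ℂ}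

variable (hG : IsGroundState r₀ v₂ v₃ n C) (H : Admissible ε r₀ v₂ v₃) (hε : 0 < ε)
  (hε' : ε < 1 / 1000)
include hG H hε hε'

theorem exists_bond_direction {x : ℂ} (hx : x ∈ C) :
    ∃ u : ℂ, ‖u‖ = 1 ∧ ∀ y ∈ neighbors r₀ C x, (y - x) ^ 4 = u ^ 4 := by
  rcases (neighbors r₀ C x).eq_empty_or_nonempty with h | ⟨z, hz⟩
  · exact ⟨1, norm_one, by simp [h]⟩
  · refine ⟨z - x, ?_, fun y hy => hG.pow_four_eq H hε hε' hx hy hz⟩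
    rw [← dist_eq_norm, dist_comm, hG.dist_eq_one H hε hε' hx hz]

theorem subset_range_rotatedLattice {x₀ u : ℂ} (hx₀ : x₀ ∈ C) (hu : u ≠ 0)
    (hdir : ∀ y ∈ neighbors r₀ C x₀, (y - x₀) ^ 4 = u ^ 4) :
    (C : Set ℂ) ⊆ Set.range (rotatedLattice x₀ u) := by
  classical
  let A := {z ∈ C | z ∈ Set.range (rotatedLattice x₀ u) ∧
    ∀ y ∈ neighbors r₀ C z, (y - z) ^ 4 = u ^ 4}
  have mem_A : x₀ ∈ A := Finset.mem_filter.2 ⟨hx₀, ⟨0, by simp [rotatedLattice]⟩, hdir⟩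
  have closed : ∀ z ∈ A, neighbors r₀ C z ⊆ A := by
    intro z hz y hy
    obtain ⟨hzC, ⟨k, rfl⟩, hz⟩ := Finset.mem_filter.1 hz
    have hyC := (mem_neighbors.1 hy).2.1
    obtain ⟨e, -, he⟩ := exists_unitStep_of_pow_four_eq hu (hz y hy)
    refine Finset.mem_filter.2 ⟨hyC, ⟨k + e, ?_⟩, fun w hw => ?_⟩
    · rw [rotatedLattice_add, ← he, add_sub_cancel]
    · rw [hG.pow_four_eq H hε hε' hyC hw (neighbors_symm hzC hy), ← hz y hy]
      ring
  rw [← hG.eq_of_neighbors_subset H hε hε' (Finset.filter_subset _ _) ⟨x₀, mem_A⟩ closed]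
  exact fun z hz => (Finset.mem_filter.1 hz).2.1

theorem exists_lattice (hn : 0 < n) : ∃ (x₀ u : ℂ) (P : Finset (ℤ × ℤ)),
    ‖u‖ = 1 ∧ #P = n ∧ C = P.image (rotatedLattice x₀ u) := by
  obtain ⟨x₀, hx₀⟩ := Finset.card_pos.1 (hG.1.symm ▸ hn)
  obtain ⟨u, hu, hdir⟩ := hG.exists_bond_direction H hε hε' hx₀
  have hu₀ : u ≠ 0 := norm_ne_zero_iff.1 (hu ▸ one_ne_zero)
  have injective := rotatedLattice_injective x₀ hu₀
  obtain ⟨P, -, hP⟩ := Finset.subset_set_image_iff.1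
    (Set.image_univ ▸ hG.subset_range_rotatedLattice H hε hε' hx₀ hu₀ hdir)
  exact ⟨x₀, u, P, hu, by rw [← hG.1, ← hP, Finset.card_image_of_injective _ injective], hP.symm⟩

section Lattice

variable {x₀ u : ℂ} (hu : ‖u‖ = 1) {P : Finset (ℤ × ℤ)} (hC : C = P.image (rotatedLattice x₀ u))
include hu hC

-- At a gap of `g` the points on the lower side would form a union of connected components.
theorem ordConnected_image {g : ℤ × ℤ → ℤ} (hg : ∀ p, ∀ e ∈ unitSteps, g (p + e) ≤ g p + 1) :
    ((P.image g : Finset ℤ) : Set ℤ).OrdConnected := by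
  have injective := rotatedLattice_injective x₀ (norm_ne_zero_iff.1 (hu ▸ one_ne_zero))
  refine Set.ordConnected_iff.2 fun a ha c hc _ b hb => Finset.mem_coe.2 ?_
  obtain ⟨p, hp, rfl⟩ := Finset.mem_image.1 ha
  obtain ⟨q, hq, rfl⟩ := Finset.mem_image.1 hc
  by_contra gap
  let A := {k ∈ P | g k < b}.image (rotatedLattice x₀ u)
  have A_subset : A ⊆ C := hC ▸ Finset.image_subset_image (Finset.filter_subset _ _)
  have hpb : g p < b := lt_of_le_of_ne hb.1 fun h => gap (h ▸ Finset.mem_image_of_mem g hp)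
  have A_nonempty : A.Nonempty :=
    ⟨_, Finset.mem_image_of_mem _ (Finset.mem_filter.2 ⟨hp, hpb⟩)⟩
  have closed : ∀ x ∈ A, neighbors r₀ C x ⊆ A := by
    intro x hx y hy
    obtain ⟨k, hk, rfl⟩ := Finset.mem_image.1 hx
    obtain ⟨l, hl, rfl⟩ := Finset.mem_image.1 (hC ▸ (mem_neighbors.1 hy).2.1)
    have step := hg k _ (H.sub_mem_unitSteps_of_mem_neighbors hu hy)
    rw [add_sub_cancel] at step
    have ne : g l ≠ b := fun h => gap (h ▸ Finset.mem_image_of_mem g hl)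
    have := (Finset.mem_filter.1 hk).2
    exact Finset.mem_image_of_mem _ (Finset.mem_filter.2 ⟨hl, by omega⟩)
  have eq_P : {k ∈ P | g k < b} = P := Finset.image_injective injective
    (hC ▸ hG.eq_of_neighbors_subset H hε hε' A_subset A_nonempty closed)
  rw [← eq_P] at hq
  exact (Finset.mem_filter.1 hq).2.not_ge hb.2

theorem card_image_fst_add_card_image_snd_le {R : ℕ} (hR : 4 * n ≤ R ^ 2) :
    #(P.image Prod.fst) + #(P.image Prod.snd) ≤ R := by
  have injective := rotatedLattice_injective x₀ (norm_ne_zero_iff.1 (hu ▸ one_ne_zero))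
  have card : #P = n := by rw [← hG.1, hC, Finset.card_image_of_injective _ injective]
  have upper := hG.realEnergy_le H hR
  have energy := H.sum_card_neighbors_add_realEnergy C
  have defect_zero := fun x (hx : x ∈ C) => hG.defect_eq_zero H hε hε' hx
  rw [Finset.sum_eq_zero defect_zero, Finset.sum_eq_zero fun x hx =>
    H.angleEnergy_eq_zero_of_defect_eq_zero (hG.finitePairs H) hx (defect_zero x hx)] at energy
  have bonds : (∑ x ∈ C, (#(neighbors r₀ C x) : ℝ)) ≤
      2 * (#(bondsAlong P (-1, 0)) + #(bondsAlong P (0, -1))) := by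
    exact_mod_cast H.sum_card_neighbors_le hu hC
  have many_bonds : 2 * n ≤ #(bondsAlong P (-1, 0)) + #(bondsAlong P (0, -1)) + R := by
    have : (2 * n : ℝ) ≤ #(bondsAlong P (-1, 0)) + #(bondsAlong P (0, -1)) + R := by linarith
    exact_mod_cast this
  have rows := card_image_add_card_bondsAlong_le P (e := (-1, 0)) (φ := Prod.snd) (ψ := Prod.fst)
    (by simp) (by simp)
  have columns := card_image_add_card_bondsAlong_le P (e := (0, -1)) (φ := Prod.fst)
    (ψ := Prod.snd) (by simp) (by simp)
  omega

end Lattice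

theorem exists_rectangle (hn : 0 < n) {R : ℕ} (hR : 4 * n ≤ R ^ 2) :
    ∃ (φ : ℂ → ℂ) (P : Finset (ℤ × ℤ)) (a b : ℕ), IsRigidMotion φ ∧ #P = n ∧
      C.image φ = P.image latticePoint ∧
      P ⊆ Finset.Icc (1 : ℤ) a ×ˢ Finset.Icc (1 : ℤ) b ∧ a + b ≤ R := by
  obtain ⟨x₀, u, P, hu, hPn, hC⟩ := hG.exists_lattice H hε hε' hn
  have hu₀ : u ≠ 0 := norm_ne_zero_iff.1 (hu ▸ one_ne_zero)
  have hP : P.Nonempty := Finset.card_pos.1 (hPn ▸ hn)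
  obtain ⟨l₁, hl₁⟩ := exists_subset_Icc_of_ordConnected (hP.image Prod.fst)
    (hG.ordConnected_image H hε hε' hu hC fun p e he => by
      rw [Prod.fst_add]
      nlinarith [mem_unitSteps.1 he, sq_nonneg e.2])
  obtain ⟨l₂, hl₂⟩ := exists_subset_Icc_of_ordConnected (hP.image Prod.snd)
    (hG.ordConnected_image H hε hε' hu hC fun p e he => by
      rw [Prod.snd_add]
      nlinarith [mem_unitSteps.1 he, sq_nonneg e.1])
  refine ⟨fun z => u⁻¹ * z + (-(u⁻¹ * x₀) - latticePoint (l₁, l₂)), P.image (· - (l₁, l₂)),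
    #(P.image Prod.fst), #(P.image Prod.snd), ⟨u⁻¹, _, by rw [norm_inv, hu, inv_one],
      fun _ => rfl⟩, ?_, ?_, fun q hq => ?_,
    hG.card_image_fst_add_card_image_snd_le H hε hε' hu hC hR⟩
  · rw [Finset.card_image_of_injective _ sub_left_injective, hPn]
  · rw [hC, Finset.image_image, Finset.image_image]
    refine Finset.image_congr fun p _ => ?_
    simp only [Function.comp_apply, rotatedLattice, map_sub]
    field_simp
    ring
  · obtain ⟨p, hp, rfl⟩ := Finset.mem_image.1 hq
    have first := Finset.mem_Icc.1 (hl₁ (Finset.mem_image_of_mem _ hp))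
    have second := Finset.mem_Icc.1 (hl₂ (Finset.mem_image_of_mem _ hp))
    simp only [Finset.mem_product, Finset.mem_Icc, Prod.fst_sub, Prod.snd_sub]
    omega

end IsGroundState

/-! ### The distance to the square -/

theorem card_sdiff_le {P : Finset (ℤ × ℤ)} {a b : ℕ}
    (hP : P ⊆ Finset.Icc (1 : ℤ) a ×ˢ Finset.Icc (1 : ℤ) b) (m : ℕ) :
    #(P \ (Finset.Icc (1 : ℤ) m ×ˢ Finset.Icc (1 : ℤ) m)) ≤ (a - m) * b + a * (b - m) := by
  calc _ ≤ #((Finset.Icc (m + 1 : ℤ) a ×ˢ Finset.Icc (1 : ℤ) b) ∪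
          (Finset.Icc (1 : ℤ) a ×ˢ Finset.Icc (m + 1 : ℤ) b)) := Finset.card_le_card fun p hp => ?_
    _ ≤ _ := Finset.card_union_le _ _
    _ = (a - m) * b + a * (b - m) := by
        simp only [Finset.card_product, Int.card_Icc, add_sub_cancel_right,
          add_sub_add_right_eq_sub, Int.toNat_natCast, Int.toNat_sub]
  obtain ⟨hp, hpm⟩ := Finset.mem_sdiff.1 hp
  have hab := hP hp
  simp only [Finset.mem_union, Finset.mem_product, Finset.mem_Icc] at hab hpm ⊢
  omega

theorem card_symmDiff_add_card {α : Type*} [DecidableEq α] (P Q : Finset α) :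
    #(P ∆ Q) + #P = #Q + 2 * #(P \ Q) := by
  have disjoint : Disjoint (P \ Q) (Q \ P) := disjoint_sdiff_sdiff
  have card_P := Finset.card_sdiff_add_card_inter P Q
  have card_Q := Finset.card_sdiff_add_card_inter Q P
  rw [Finset.inter_comm] at card_Q
  rw [symmDiff_def, Finset.sup_eq_union, Finset.card_union_of_disjoint disjoint]
  omega

theorem le_of_add_le_of_le_mul {a b t : ℝ} (ht : 1 ≤ t) (hab : a + b ≤ 2 * t ^ 2 + 1)
    (h₀ : 0 ≤ a + b) (h : t ^ 4 ≤ a * b) : a ≤ t ^ 2 + 2 * t := by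
  have diff_sq : (a - b) ^ 2 ≤ (2 * t + 1) ^ 2 := by
    calc (a - b) ^ 2 = (a + b) ^ 2 - 4 * (a * b) := by ring
      _ ≤ (2 * t ^ 2 + 1) ^ 2 - 4 * t ^ 4 := by gcongr
      _ ≤ (2 * t + 1) ^ 2 := by linarith
  linarith [abs_le_of_sq_le_sq diff_sq (by linarith), le_abs_self (a - b)]

theorem natCast_sub_le {a m : ℕ} {r s : ℝ} (hr : 0 ≤ r) (hm : s ≤ m) (ha : (a : ℝ) ≤ s + r) :
    ((a - m : ℕ) : ℝ) ≤ r := by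
  rcases le_total a m with h | h
  · rwa [Nat.sub_eq_zero_of_le h, Nat.cast_zero]
  · rw [Nat.cast_sub h]
    linarith

section NearSquare

variable {P : Finset (ℤ × ℤ)} {a b m : ℕ} {t : ℝ} (ht : 1 ≤ t) (hcard : (#P : ℝ) = t ^ 4)
  (hP : P ⊆ Finset.Icc (1 : ℤ) a ×ˢ Finset.Icc (1 : ℤ) b) (hab : (a + b : ℝ) ≤ 2 * t ^ 2 + 1)
  (hm : t ^ 2 ≤ m)
include ht hcard hP hab hm

theorem card_sdiff_square_le :
    (#(P \ (Finset.Icc (1 : ℤ) m ×ˢ Finset.Icc (1 : ℤ) m)) : ℝ) ≤ 12 * t ^ 3 := by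
  have area : t ^ 4 ≤ (a * b : ℝ) := by
    have := Finset.card_le_card hP
    simp only [Finset.card_product, Int.card_Icc, add_sub_cancel_right, Int.toNat_natCast] at this
    rw [← hcard]
    exact_mod_cast this
  have ha := le_of_add_le_of_le_mul ht hab (by positivity) area
  have hb := le_of_add_le_of_le_mul ht (add_comm (a : ℝ) b ▸ hab) (by positivity)
    (mul_comm (a : ℝ) b ▸ area)
  have side : t ^ 2 + 2 * t ≤ 3 * t ^ 2 := by nlinarith
  calc _ ≤ ((a - m : ℕ) * b + a * (b - m : ℕ) : ℝ) := by exact_mod_cast card_sdiff_le hP m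
    _ ≤ 2 * t * (3 * t ^ 2) + 3 * t ^ 2 * (2 * t) := by
      gcongr
      exacts [natCast_sub_le (by positivity) hm ha, hb.trans side, ha.trans side,
        natCast_sub_le (by positivity) hm hb]
    _ = 12 * t ^ 3 := by ring

theorem card_symmDiff_square_le (hm' : (m : ℝ) ≤ t ^ 2 + 1) :
    (#(P ∆ (Finset.Icc (1 : ℤ) m ×ˢ Finset.Icc (1 : ℤ) m)) : ℝ) ≤ 27 * t ^ 3 := by
  have sdiff := card_sdiff_square_le ht hcard hP hab hm
  have square : (m : ℝ) ^ 2 ≤ t ^ 4 + 3 * t ^ 3 := by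
    have one_le : 1 ≤ t ^ 3 := one_le_pow₀ ht
    have sq_le : t ^ 2 ≤ t ^ 3 := pow_le_pow_right₀ ht (by norm_num)
    calc (m : ℝ) ^ 2 ≤ (t ^ 2 + 1) ^ 2 := by gcongr
      _ = t ^ 4 + 2 * t ^ 2 + 1 := by ring
      _ ≤ t ^ 4 + 3 * t ^ 3 := by linarith
  have total : (#(P ∆ (Finset.Icc (1 : ℤ) m ×ˢ Finset.Icc (1 : ℤ) m)) + t ^ 4 : ℝ) =
      (m : ℝ) ^ 2 + 2 * #(P \ (Finset.Icc (1 : ℤ) m ×ˢ Finset.Icc (1 : ℤ) m)) := by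
    have := card_symmDiff_add_card P (Finset.Icc (1 : ℤ) m ×ˢ Finset.Icc (1 : ℤ) m)
    rw [Finset.card_product, Int.card_Icc, add_sub_cancel_right, Int.toNat_natCast, ← sq] at this
    rw [← hcard]
    exact_mod_cast this
  linarith

end NearSquare

theorem square_eq_image (n : ℕ) : square n =
    (Finset.Icc (1 : ℤ) ⌈√n⌉₊ ×ˢ Finset.Icc (1 : ℤ) ⌈√n⌉₊).image latticePoint := by
  rw [square, Int.natCast_ceil_eq_ceil (Real.sqrt_nonneg _)]
  rfl

theorem IsGroundState.exists_card_symmDiff_square_le {ε r₀ : ℝ} {v₂ : ℝ → EReal} {v₃ : ℝ → ℝ}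
    {n : ℕ} {C : Finset ℂ} (hG : IsGroundState r₀ v₂ v₃ n C) (H : Admissible ε r₀ v₂ v₃)
    (hε : 0 < ε) (hε' : ε < 1 / 1000) {t : ℝ} (ht : 1 ≤ t) (hn : (n : ℝ) = t ^ 4) :
    ∃ φ : ℂ → ℂ, IsRigidMotion φ ∧ (#((C.image φ) ∆ (square n)) : ℝ) ≤ 27 * t ^ 3 := by
  have sqrt_eq : √n = t ^ 2 := by
    rw [hn, show t ^ 4 = (t ^ 2) ^ 2 by ring, Real.sqrt_sq (by positivity)]
  have n_pos : 0 < n := by exact_mod_cast hn ▸ (by positivity : 0 < t ^ 4)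
  have hR : 4 * n ≤ ⌈2 * t ^ 2⌉₊ ^ 2 := by
    have : (4 * n : ℝ) ≤ (⌈2 * t ^ 2⌉₊ : ℝ) ^ 2 := by
      calc (4 * n : ℝ) = (2 * t ^ 2) ^ 2 := by rw [hn]; ring
        _ ≤ _ := by gcongr; exact Nat.le_ceil _
    exact_mod_cast this
  obtain ⟨φ, P, a, b, hφ, hPn, hCP, hP, hab⟩ := hG.exists_rectangle H hε hε' n_pos hR
  have hab : (a + b : ℝ) ≤ 2 * t ^ 2 + 1 :=
    (by exact_mod_cast hab : (a + b : ℝ) ≤ ⌈2 * t ^ 2⌉₊).trans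
      (Nat.ceil_lt_add_one (by positivity)).le
  refine ⟨φ, hφ, ?_⟩
  rw [hCP, square_eq_image, ← Finset.image_symmDiff _ _ latticePoint_injective,
    Finset.card_image_of_injective _ latticePoint_injective, sqrt_eq]
  exact card_symmDiff_square_le ht (hPn ▸ hn) hP hab (Nat.le_ceil _)
    (Nat.ceil_lt_add_one (by positivity)).le

end SquareCrystal

end

theorem theorem2 :
    ∃ ε₀ : ℝ, 0 < ε₀ ∧ ε₀ < Real.pi / 6 ∧ ∃ c : ℝ, 0 < c ∧
      ∀ (ε r₀ : ℝ) (v₂ : ℝ → EReal) (v₃ : ℝ → ℝ), 0 < ε → ε < ε₀ →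
        SquareCrystal.Admissible ε r₀ v₂ v₃ →
        ∀ (n : ℕ) (C : Finset ℂ), SquareCrystal.IsGroundState r₀ v₂ v₃ n C →
          ∃ φ : ℂ → ℂ, SquareCrystal.IsRigidMotion φ ∧
            (((C.image φ) ∆ (SquareCrystal.square n)).card : ℝ) ≤ c * (n : ℝ) ^ (3 / 4 : ℝ) := by
  refine ⟨1 / 1000, by norm_num, by linarith [Real.pi_gt_three], 27, by norm_num, ?_⟩
  intro ε r₀ v₂ v₃ hε hε' H n C hG
  rcases Nat.eq_zero_or_pos n with rfl | hn
  · refine ⟨id, ⟨1, 0, norm_one, by simp⟩, ?_⟩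
    simp [Finset.card_eq_zero.1 hG.1, SquareCrystal.square_eq_image]
  have fourth_power : (n : ℝ) = ((n : ℝ) ^ (1 / 4 : ℝ)) ^ 4 := by
    rw [← Real.rpow_natCast, ← Real.rpow_mul n.cast_nonneg]
    norm_num
  have cube : (n : ℝ) ^ (3 / 4 : ℝ) = ((n : ℝ) ^ (1 / 4 : ℝ)) ^ 3 := by
    rw [← Real.rpow_natCast, ← Real.rpow_mul n.cast_nonneg]
    norm_num
  rw [cube]
  exact hG.exists_card_symmDiff_square_le H hε hε'
    (Real.one_le_rpow (by exact_mod_cast hn) (by norm_num)) fourth_power
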